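/- Let $V$ be an $\mathbb{F}_2\mathcal{A}_9$-module of dimension $8$ that is an irreducible constituent of the restriction to $\mathcal{A}_9$ of the spin module $D^{(5,4)}$ of the symmetric group $\Sigma_9$. (Here $D^{(5,4)}=S/(S\cap S^\perp)$, where $S=S^{(5,4)}$ is the Specht module over $\mathbb{F}_2$, i.e. the span of the polytabloids in the permutation module on tabloids of shape $(5,4)$, and $\perp$ refers to the bilinear form for which the tabloids are orthonormal.) Then $V$ is of quadratic type, that is, there is an $\mathcal{A}_9$-invariant quadratic form $Q:V\to\mathbb{F}_2$ whose polarization is a non-degenerate bilinear form. Let $\mathcal{A}_8\le\mathcal{A}_9$ be the stabilizer of one of the nine letters, and let $U$ be an irreducible $\mathbb{F}_2\mathcal{A}_8$-submodule of $V$. Then $\dim U=4$, and for every such form $Q$ on $V$ the subspace $U$ is totally singular, i.e. $Q(u)=0$ for all $u\in U$. Moreover, if $g_1,\dots,g_9$ is a set of representatives for the left cosets $g\mathcal{A}_8$ of $\mathcal{A}_8$ in $\mathcal{A}_9$, then the subspaces $g_iU$, $1\le i\le 9$, form a complete orthogonal spread of $(V,Q)$: they are $4$-dimensional and totally singular, they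 are nine distinct subspaces (the maximum possible number $2^{4-1}+1$), and any two of them intersect trivially. -/

import Mathlib

open Module

/-! ### The irreducible modules labelled by partitions with two parts

Let `2 * k ≤ n`. A tabloid of shape `(n - k, k)` is determined by its second row, a `k`-subset of
`{0, …, n - 1}`. -/

/-- The permutation module `M^{(n-k,k)}` over `𝔽₂`: functions on the tabloids of shape
`(n - k, k)`, each tabloid being given by the set of the entries of its second row. -/
abbrev TabloidModule (n k : ℕ) : Type := Set.powersetCard (Fin n) k → ZMod 2

/-- The action of the symmetric group on `M^{(n-k,k)}` by permutation of the tabloids. -/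
def tabloidRep (n k : ℕ) : Representation (ZMod 2) (Equiv.Perm (Fin n)) (TabloidModule n k) where
  toFun σ := LinearMap.funLeft (ZMod 2) (ZMod 2) fun s => σ⁻¹ • s
  map_one' := by
    ext f s
    simp [LinearMap.funLeft_apply]
  map_mul' σ τ := by
    refine LinearMap.ext fun f => funext fun s => ?_
    simp [LinearMap.funLeft_apply, mul_smul]

/-- The two-rowed columns of a tableau of shape `(n - k, k)`: the `i`-th column has the entry
`t (Sum.inl i)` in the first row and `t (Sum.inr i)` in the second row. (The other entries of the
first row stand in columns of length one and do not matter for the polytabloid.) -/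
abbrev TwoRowTableau (n k : ℕ) : Type := Fin k ⊕ Fin k ↪ Fin n

/-- The second row of the tableau obtained from `t` by interchanging the two entries of the `i`-th
column for every `i ∈ A`. These interchanges are the elements of the column stabilizer. -/
def TwoRowTableau.secondRow {n k : ℕ} (t : TwoRowTableau n k) (A : Finset (Fin k)) :
    Fin k ↪ Fin n where
  toFun i := if i ∈ A then t (Sum.inl i) else t (Sum.inr i)
  inj' i j h := by
    dsimp only at h
    split_ifs at h
    · exact Sum.inl_injective (t.injective h)
    · exact absurd (t.injective h) Sum.inl_ne_inr
    · exact absurd (t.injective h) Sum.inr_ne_inl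
    · exact Sum.inr_injective (t.injective h)

theorem TwoRowTableau.secondRow_apply {n k : ℕ} (t : TwoRowTableau n k) (A : Finset (Fin k))
    (i : Fin k) : t.secondRow A i = if i ∈ A then t (Sum.inl i) else t (Sum.inr i) := rfl

/-- The polytabloid of `t`: the sum of the tabloids `π t` over the column stabilizer of `t`
(in characteristic two the signs are trivial). -/
def polytabloid {n k : ℕ} (t : TwoRowTableau n k) : TabloidModule n k :=
  ∑ A : Finset (Fin k), Pi.single (Set.powersetCard.ofFinEmb k (Fin n) (t.secondRow A)) 1

/-- The Specht module `S^{(n-k,k)}` over `𝔽₂`, the span of the polytabloids. -/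
def spechtSubmodule (n k : ℕ) : Submodule (ZMod 2) (TabloidModule n k) :=
  Submodule.span (ZMod 2) (Set.range polytabloid)

/-- The orthogonal complement of the Specht module for the bilinear form on `M^{(n-k,k)}` in which
the tabloids are orthonormal. -/
def spechtOrthogonal (n k : ℕ) : Submodule (ZMod 2) (TabloidModule n k) where
  carrier := {x | ∀ y ∈ spechtSubmodule n k, ∑ s, x s * y s = 0}
  zero_mem' := by simp
  add_mem' {x x'} hx hx' y hy := by
    simp only [Pi.add_apply, add_mul, Finset.sum_add_distrib]
    rw [hx y hy, hx' y hy, add_zero]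
  smul_mem' c x hx y hy := by
    simp only [Pi.smul_apply, smul_eq_mul, mul_assoc, ← Finset.mul_sum]
    rw [hx y hy, mul_zero]

theorem tabloidRep_apply {n k : ℕ} (σ : Equiv.Perm (Fin n)) (f : TabloidModule n k)
    (s : Set.powersetCard (Fin n) k) : tabloidRep n k σ f s = f (σ⁻¹ • s) := rfl

theorem tabloidRep_polytabloid {n k : ℕ} (σ : Equiv.Perm (Fin n)) (t : TwoRowTableau n k) :
    tabloidRep n k σ (polytabloid t) = polytabloid (t.trans σ.toEmbedding) := by
  simp only [polytabloid, map_sum]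
  refine Finset.sum_congr rfl fun A _ => funext fun s => ?_
  rw [tabloidRep_apply, Pi.single_apply, Pi.single_apply]
  refine if_congr ?_ rfl rfl
  rw [inv_smul_eq_iff]
  have h : σ • Set.powersetCard.ofFinEmb k (Fin n) (t.secondRow A) =
      Set.powersetCard.ofFinEmb k (Fin n)
        (TwoRowTableau.secondRow (t.trans σ.toEmbedding) A) := by
    apply Subtype.ext
    rw [Set.powersetCard.coe_smul, Set.powersetCard.val_ofFinEmb, Set.powersetCard.val_ofFinEmb]
    ext x
    simp only [Finset.mem_smul_finset, Finset.mem_map, Finset.mem_univ, true_and]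
    constructor
    · rintro ⟨_, ⟨i, rfl⟩, rfl⟩
      refine ⟨i, ?_⟩
      by_cases hi : i ∈ A <;> simp [TwoRowTableau.secondRow_apply, hi]
    · rintro ⟨i, rfl⟩
      refine ⟨_, ⟨i, rfl⟩, ?_⟩
      by_cases hi : i ∈ A <;> simp [TwoRowTableau.secondRow_apply, hi]
  rw [h]

theorem tabloidRep_mem_specht {n k : ℕ} (σ : Equiv.Perm (Fin n)) ⦃x : TabloidModule n k⦄
    (hx : x ∈ spechtSubmodule n k) : tabloidRep n k σ x ∈ spechtSubmodule n k := by
  refine Submodule.span_induction (p := fun x _ => tabloidRep n k σ x ∈ spechtSubmodule n k)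
    ?_ ?_ ?_ ?_ hx
  · rintro _ ⟨t, rfl⟩
    rw [tabloidRep_polytabloid]
    exact Submodule.subset_span ⟨_, rfl⟩
  · simp
  · intro x y _ _ hx hy
    rw [map_add]
    exact add_mem hx hy
  · intro c x _ hx
    rw [map_smul]
    exact Submodule.smul_mem _ c hx

theorem tabloidRep_mem_orthogonal {n k : ℕ} (σ : Equiv.Perm (Fin n)) ⦃x : TabloidModule n k⦄
    (hx : x ∈ spechtOrthogonal n k) : tabloidRep n k σ x ∈ spechtOrthogonal n k := by
  intro y hy
  rw [← hx _ (tabloidRep_mem_specht σ⁻¹ hy), ← Equiv.sum_comp (MulAction.toPerm σ)]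
  simp [tabloidRep_apply]

/-- The Specht module `S^{(n-k,k)}` as a representation of the symmetric group. -/
def spechtRep (n k : ℕ) :
    Representation (ZMod 2) (Equiv.Perm (Fin n)) (spechtSubmodule n k) :=
  (tabloidRep n k).subrepresentation (spechtSubmodule n k)
    fun σ _ hx => tabloidRep_mem_specht σ hx

/-- The submodule `S ∩ S^⊥` of the Specht module `S = S^{(n-k,k)}`. -/
def spechtRadical (n k : ℕ) : Submodule (ZMod 2) (spechtSubmodule n k) :=
  (spechtOrthogonal n k).comap (spechtSubmodule n k).subtype

/-- The module `D^{(n-k,k)} = S / (S ∩ S^⊥)` over `𝔽₂`, where `S = S^{(n-k,k)}`; it is irreducible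
if `(n - k, k)` is a 2-regular partition of `n`, that is, `2 * k < n`. -/
abbrev TwoPartModule (n k : ℕ) : Type := spechtSubmodule n k ⧸ spechtRadical n k

/-- The action of the symmetric group on `D^{(n-k,k)}`. -/
def twoPartRep (n k : ℕ) :
    Representation (ZMod 2) (Equiv.Perm (Fin n)) (TwoPartModule n k) :=
  (spechtRep n k).quotient (spechtRadical n k)
    fun σ _ hx => tabloidRep_mem_orthogonal σ hx

/-! ### Constituents, quadratic forms and orthogonal spreads -/

section

variable {K G V W : Type*} [Field K] [AddCommGroup V] [Module K V] [AddCommGroup W] [Module K W]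

/-- `ρ` is an irreducible constituent (composition factor) of `σ`: it is irreducible and isomorphic
to a quotient of a submodule of `σ`. -/
def IsIrreducibleConstituent [Group G] (ρ : Representation K G V) (σ : Representation K G W) :
    Prop :=
  ρ.IsIrreducible ∧
    ∃ (A : Subrepresentation σ) (f : A.toRepresentation.IntertwiningMap ρ), Function.Surjective f

/-- `Q` is a non-degenerate quadratic form on `V` (its polarization is a non-degenerate bilinear
form) that is invariant under `G`. -/
def IsNondegenerateInvariantForm [Group G] (ρ : Representation K G V) (Q : QuadraticForm K V) :
    Prop :=
  (QuadraticMap.polarBilin Q).Nondegenerate ∧ ∀ g v, Q (ρ g v) = Q v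

/-- `ρ` is of quadratic type: it carries a non-degenerate invariant quadratic form. -/
def IsOfQuadraticType [Group G] (ρ : Representation K G V) : Prop :=
  ∃ Q : QuadraticForm K V, IsNondegenerateInvariantForm ρ Q

/-- All vectors of `U` are singular. -/
def IsTotallySingular (Q : QuadraticForm K V) (U : Submodule K V) : Prop :=
  ∀ u ∈ U, Q u = 0

/-- With `dim V = 2 * r`: a set of `r`-dimensional totally singular subspaces of `V` that intersect
trivially in pairs. -/
def IsPartialOrthogonalSpread (Q : QuadraticForm K V) (r : ℕ) (S : Set (Submodule K V)) : Prop :=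
  finrank K V = 2 * r ∧ (∀ U ∈ S, finrank K U = r ∧ IsTotallySingular Q U) ∧
    ∀ U ∈ S, ∀ U' ∈ S, U ≠ U' → U ⊓ U' = ⊥

/-- A partial orthogonal spread of the maximal size `q ^ (r - 1) + 1`, where `q = |K|`. -/
def IsCompleteOrthogonalSpread (Q : QuadraticForm K V) (S : Set (Submodule K V)) : Prop :=
  ∃ r, 0 < r ∧ IsPartialOrthogonalSpread Q r S ∧ S.ncard = Nat.card K ^ (r - 1) + 1

end

/-! ### The alternating groups -/

/-- The alternating group on nine letters. -/
abbrev A9 : Type := alternatingGroup (Fin 9)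

/-- The subgroup `A₈` of `A₉`, the stabilizer of the letter `a`. -/
abbrev A8 (a : Fin 9) : Subgroup A9 := MulAction.stabilizer A9 a

/-- The restriction to `A₉` of the spin module `D^{(5,4)}` of the symmetric group on nine
letters. -/
def spinRepA9 : Representation (ZMod 2) A9 (TwoPartModule 9 4) :=
  (twoPartRep 9 4).comp (alternatingGroup (Fin 9)).subtype

/-!
The even vectors of `𝔽₂⁹`, with the quadratic form `q(w) = wt(w) / 2`, form a nondegenerate
quadratic space of dimension 8. In its Clifford algebra the vectors `e i + e j` are involutions
that multiply like the transpositions `(i j)`, and a product of two of them that do not commute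
satisfies `1 + c + c² = 0`. Conversely these relations for the three-cycles turn a module for `A₉`
into a module for the even Clifford algebra. The whole proof rests on them.

The relations hold on `D^{(5,4)}` (`three_cycle_norm_mem_orthogonal`), hence on the constituent
`V`. Since vectors are odd, they act as maps between `V` and its twist by the transposition `(0 1)`
(`toTwist`, `ofTwist`); these maps satisfy the Clifford relation (`ofTwist_mul_toTwist`).

For a letter `a` the vector `z a = ∑ i ≠ a, e i` is singular and fixed by the stabilizer of `a`.
Two such vectors form a hyperbolic pair, `z a * z b + z b * z a = 1`, so that their kernels on `V`
are complementary (`isCompl_spreadMember`). Hence the nine kernels have dimension 4, intersect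
trivially in pairs, and are permuted by `A₉` like the letters. Vectors are self-adjoint for every
invariant form and the kernel of `z a` is also the range of `z a`, so it is isotropic; the
quadratic form is then additive on it and invariant under a three-cycle, and the relation
`1 + c + c² = 0` makes it vanish (`isTotallySingular_spreadMember`). An irreducible submodule `U`
for the stabilizer of `a` lies in the kernel of `z a`: if `r` is the vector of a transposition
fixing `a`, then `z a * r` belongs to the image of the group algebra of the stabilizer, and it maps
`U` into the kernel of `z a` (`le_spreadMember`). Two disjoint three-cycles fixing `a` show that
`4` divides `dim U`, so `U` is the whole kernel (`toSubmodule_eq_spreadMember`).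

For the existence of an invariant form (`isOfQuadraticType_of_hasSpinRelation`), the three
commuting three-cycles `(0 1 2)`, `(3 4 5)`, `(6 7 8)` decompose `V` into four planes. Let `Q v` be
the number modulo two of the nonzero components of `v`; it is a quadratic form because the
indicator function of the nonzero vectors of a plane over `𝔽₂` is one. It is invariant under all
operators permuting the planes, and among these are the operators of the vectors of a basis of the
quadratic space. These are therefore self-adjoint for the polar form, and as self-adjointness is
linear in the vector, all transpositions are self-adjoint: the polar form is invariant under `A₉`.
Finally, `Q` is invariant under `(0 1 2)`, and two forms with equal polar form that are invariant
under the same three-cycle coincide; this carries the invariance of `Q` over to disjoint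
three-cycles (`apply_eq_of_three_cycle`).
-/

/-! ### Three-cycles on the Specht module -/

section TabloidSums

variable {n k : ℕ}

/-- The sum of the coefficients of `x` over the tabloids whose second row contains `T`. -/
def supersetSum (x : TabloidModule n k) (T : Finset (Fin n)) : ZMod 2 :=
  ∑ s, if T ⊆ s.val then x s else 0

/-- Fewer than `k` letters miss some column of `t`; interchanging the two entries of that column
pairs off the tabloids in `polytabloid t` whose second row contains these letters. -/
theorem supersetSum_polytabloid (t : TwoRowTableau n k) {T : Finset (Fin n)} (hT : T.card < k) :
    supersetSum (polytabloid t) T = 0 := by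
  obtain ⟨i, hi⟩ : ∃ i : Fin k, ∀ x ∈ T, x ≠ t (Sum.inl i) ∧ x ≠ t (Sum.inr i) := by
    by_contra! h
    have key : ∀ i : Fin k, ∃ x ∈ T, x = t (Sum.inl i) ∨ x = t (Sum.inr i) := by
      intro i
      obtain ⟨x, hx, h'⟩ := h i
      exact ⟨x, hx, or_iff_not_imp_left.2 h'⟩
    choose f hf hf' using key
    have hinj : Function.Injective f := by
      intro i j hij
      have hj := hf' j
      rw [← hij] at hj
      rcases hf' i with h1 | h1 <;> rcases hj with h2 | h2 <;>
        simpa using t.injective (h1.symm.trans h2)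
    have := Finset.card_le_card_of_injOn f (fun i _ => hf i)
      (hinj.injOn (s := (Finset.univ : Finset (Fin k))))
    simp only [Finset.card_univ, Fintype.card_fin] at this
    omega
  have hmem (A : Finset (Fin k)) (x : Fin n) (hx : x ∈ T) :
      x ∈ Set.powersetCard.ofFinEmb k (Fin n) (t.secondRow A) ↔
        ∃ j, j ≠ i ∧ t.secondRow A j = x := by
    rw [Set.powersetCard.mem_ofFinEmb_iff_mem_range]
    constructor
    · rintro ⟨j, rfl⟩
      refine ⟨j, ?_, rfl⟩
      rintro rfl
      have := hi _ hx
      rw [TwoRowTableau.secondRow_apply] at this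
      split_ifs at this <;> simp at this
    · rintro ⟨j, -, rfl⟩
      exact ⟨j, rfl⟩
  have hcomm : supersetSum (polytabloid t) T = ∑ A : Finset (Fin k),
      if T ⊆ (Set.powersetCard.ofFinEmb k (Fin n) (t.secondRow A)).val then 1 else 0 := by
    simp only [supersetSum, polytabloid, Finset.sum_apply, ← Finset.sum_filter]
    rw [Finset.sum_comm, Finset.sum_filter]
    refine Finset.sum_congr rfl fun A _ => ?_
    simp [Pi.single_apply]
  rw [hcomm]
  refine Finset.sum_involution (fun A _ => symmDiff A {i}) ?_ ?_ ?_ ?_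
  · intro A _
    have : T ⊆ (Set.powersetCard.ofFinEmb k (Fin n) (t.secondRow (symmDiff A {i}))).val ↔
        T ⊆ (Set.powersetCard.ofFinEmb k (Fin n) (t.secondRow A)).val := by
      refine forall₂_congr fun x hx => ?_
      rw [Set.powersetCard.mem_coe_iff, Set.powersetCard.mem_coe_iff, hmem _ _ hx, hmem _ _ hx]
      refine exists_congr fun j => and_congr_right fun hj => ?_
      rw [TwoRowTableau.secondRow_apply, TwoRowTableau.secondRow_apply]
      simp [Finset.mem_symmDiff, hj]
    simp only [this]
    exact ZModModule.add_self _
  · intro A _ _ h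
    have := congrArg (i ∈ ·) h
    simp [Finset.mem_symmDiff] at this
  · intro A _
    exact Finset.mem_univ _
  · intro A _
    exact symmDiff_symmDiff_cancel_right _ _

theorem supersetSum_eq_zero {x : TabloidModule n k} (hx : x ∈ spechtSubmodule n k)
    {T : Finset (Fin n)} (hT : T.card < k) : supersetSum x T = 0 := by
  induction hx using Submodule.span_induction with
  | mem x h =>
    obtain ⟨t, rfl⟩ := h
    exact supersetSum_polytabloid t hT
  | zero => simp [supersetSum]
  | add x y _ _ hx hy =>
    rw [supersetSum] at hx hy ⊢
    simp only [Pi.add_apply, ite_add_zero, Finset.sum_add_distrib, hx, hy, add_zero]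
  | smul c x _ hx =>
    rw [← smul_zero c, ← hx, supersetSum, supersetSum, Finset.smul_sum]
    refine Finset.sum_congr rfl fun s _ => ?_
    split_ifs <;> simp

/-- Möbius inversion modulo two: an interval `[A, s ∩ R]` of sets has an odd number of elements
only if `A = s ∩ R`. -/
theorem sum_inter_eq (x : TabloidModule n k) {A R : Finset (Fin n)} (hA : A ⊆ R) :
    (∑ s, if s.val ∩ R = A then x s else 0) = ∑ T ∈ R.powerset with A ⊆ T, supersetSum x T := by
  simp only [supersetSum]
  rw [Finset.sum_comm]
  refine Finset.sum_congr rfl fun s _ => ?_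
  rw [← Finset.sum_filter, Finset.sum_const]
  have hI : {T ∈ {T ∈ R.powerset | A ⊆ T} | T ⊆ s.val} = Finset.Icc A (s.val ∩ R) := by
    ext T
    simp only [Finset.mem_filter, Finset.mem_powerset, Finset.mem_Icc,
      Finset.subset_inter_iff]
    tauto
  rw [hI]
  by_cases h : A ⊆ s.val ∩ R
  · rw [Finset.card_Icc_finset h]
    split_ifs with h'
    · simp [h']
    · have : A.card < (s.val ∩ R).card :=
        Finset.card_lt_card (h.ssubset_of_ne (Ne.symm h'))
      obtain ⟨m, hm⟩ := Nat.exists_eq_add_of_lt this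
      rw [show (s.val ∩ R).card - A.card = m + 1 by omega, pow_succ, mul_comm, mul_smul,
        two_smul, ZModModule.add_self]
  · rw [Finset.Icc_eq_empty (by simpa using h), if_neg]
    · simp
    · rintro rfl
      exact h subset_rfl

/-- Two equinumerous subsets of a set of three elements lie in one orbit of the three-cycle, and an
orbit has one or three elements. -/
theorem sum_three_cycle_indicator_bool : ∀ a₁ a₂ a₃ b₁ b₂ b₃ : Bool,
    ((if a₁ = true then 1 else 0) + (if a₂ = true then 1 else 0) + (if a₃ = true then 1 else 0) : ℕ)
      = (if b₁ = true then 1 else 0) + (if b₂ = true then 1 else 0) +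
        (if b₃ = true then 1 else 0) →
    ((if b₁ = a₁ ∧ b₂ = a₂ ∧ b₃ = a₃ then 1 else 0) +
      (if b₁ = a₂ ∧ b₂ = a₃ ∧ b₃ = a₁ then 1 else 0) +
      (if b₁ = a₃ ∧ b₂ = a₁ ∧ b₃ = a₂ then 1 else 0) : ZMod 2) = 1 := by
  decide

/-- Two `k`-subsets that agree outside `{i, j, l}` have equally many elements in `{i, j, l}`, hence
lie in one orbit of the three-cycle; this orbit has one or three elements. -/
theorem sum_three_cycle_indicator {i j l : Fin n} (hij : i ≠ j) (hjl : j ≠ l) (hil : i ≠ l)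
    (s s' : Set.powersetCard (Fin n) k) :
    ((if s' = s then 1 else 0) +
      (if s' = (Equiv.swap i j * Equiv.swap j l)⁻¹ • s then 1 else 0) +
      (if s' = (Equiv.swap i j * Equiv.swap i l)⁻¹ • s then 1 else 0) : ZMod 2) =
      if s'.val ∩ {i, j, l}ᶜ = s.val ∩ {i, j, l}ᶜ then 1 else 0 := by
  have hsmul (σ : Equiv.Perm (Fin n)) : s' = σ⁻¹ • s ↔ ∀ x, x ∈ s'.val ↔ σ x ∈ s.val := by
    rw [Subtype.ext_iff, Finset.ext_iff]
    refine forall_congr' fun x => ?_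
    rw [Set.powersetCard.coe_smul, Finset.mem_inv_smul_finset_iff, Equiv.Perm.smul_def]
  have hone : s' = s ↔ ∀ x, x ∈ s'.val ↔ x ∈ s.val := by
    rw [Subtype.ext_iff, Finset.ext_iff]
  have split (p : Fin n → Prop) :
      (∀ x, p x) ↔ p i ∧ p j ∧ p l ∧ ∀ x, x ≠ i → x ≠ j → x ≠ l → p x := by
    refine ⟨fun h => ⟨h i, h j, h l, fun x _ _ _ => h x⟩, fun ⟨h1, h2, h3, h4⟩ x => ?_⟩
    by_cases hi : x = i
    · exact hi ▸ h1
    by_cases hj : x = j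
    · exact hj ▸ h2
    by_cases hl : x = l
    · exact hl ▸ h3
    exact h4 x hi hj hl
  have hci : (Equiv.swap i j * Equiv.swap j l) i = j := by
    simp [Equiv.swap_apply_of_ne_of_ne hij hil]
  have hcj : (Equiv.swap i j * Equiv.swap j l) j = l := by
    simp [Equiv.swap_apply_of_ne_of_ne hil.symm hjl.symm]
  have hcl : (Equiv.swap i j * Equiv.swap j l) l = i := by simp
  have hdi : (Equiv.swap i j * Equiv.swap i l) i = l := by
    simp [Equiv.swap_apply_of_ne_of_ne hil.symm hjl.symm]
  have hdj : (Equiv.swap i j * Equiv.swap i l) j = i := by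
    simp [Equiv.swap_apply_of_ne_of_ne hij.symm hjl]
  have hdl : (Equiv.swap i j * Equiv.swap i l) l = j := by simp
  have hc (x) (h1 : x ≠ i) (h2 : x ≠ j) (h3 : x ≠ l) :
      (Equiv.swap i j * Equiv.swap j l) x = x := by
    simp [Equiv.swap_apply_of_ne_of_ne, *]
  have hd (x) (h1 : x ≠ i) (h2 : x ≠ j) (h3 : x ≠ l) :
      (Equiv.swap i j * Equiv.swap i l) x = x := by
    simp [Equiv.swap_apply_of_ne_of_ne, *]
  have hR : s'.val ∩ {i, j, l}ᶜ = s.val ∩ {i, j, l}ᶜ ↔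
      ∀ x, x ≠ i → x ≠ j → x ≠ l → (x ∈ s'.val ↔ x ∈ s.val) := by
    rw [Finset.ext_iff]
    refine forall_congr' fun x => ?_
    simp only [Finset.mem_inter, Finset.mem_compl, Finset.mem_insert, Finset.mem_singleton,
      not_or]
    tauto
  have e0 : s' = s ↔ (i ∈ s'.val ↔ i ∈ s.val) ∧ (j ∈ s'.val ↔ j ∈ s.val) ∧
      (l ∈ s'.val ↔ l ∈ s.val) ∧ s'.val ∩ {i, j, l}ᶜ = s.val ∩ {i, j, l}ᶜ := by
    rw [hone, split, hR]
  have e1 : s' = (Equiv.swap i j * Equiv.swap j l)⁻¹ • s ↔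
      (i ∈ s'.val ↔ j ∈ s.val) ∧ (j ∈ s'.val ↔ l ∈ s.val) ∧
      (l ∈ s'.val ↔ i ∈ s.val) ∧ s'.val ∩ {i, j, l}ᶜ = s.val ∩ {i, j, l}ᶜ := by
    rw [hsmul, split, hci, hcj, hcl, hR]
    refine and_congr_right fun _ => and_congr_right fun _ => and_congr_right fun _ =>
      forall_congr' fun x => forall₃_congr fun h1 h2 h3 => ?_
    rw [hc x h1 h2 h3]
  have e2 : s' = (Equiv.swap i j * Equiv.swap i l)⁻¹ • s ↔
      (i ∈ s'.val ↔ l ∈ s.val) ∧ (j ∈ s'.val ↔ i ∈ s.val) ∧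
      (l ∈ s'.val ↔ j ∈ s.val) ∧ s'.val ∩ {i, j, l}ᶜ = s.val ∩ {i, j, l}ᶜ := by
    rw [hsmul, split, hdi, hdj, hdl, hR]
    refine and_congr_right fun _ => and_congr_right fun _ => and_congr_right fun _ =>
      forall_congr' fun x => forall₃_congr fun h1 h2 h3 => ?_
    rw [hd x h1 h2 h3]
  simp only [e0, e1, e2]
  by_cases h : s'.val ∩ {i, j, l}ᶜ = s.val ∩ {i, j, l}ᶜ
  swap
  · simp only [h, and_false, if_false, add_zero]
  have hcard (u : Set.powersetCard (Fin n) k) : k = (u.val ∩ {i, j, l}ᶜ).card +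
      ((if i ∈ u.val then 1 else 0) + (if j ∈ u.val then 1 else 0) +
        (if l ∈ u.val then 1 else 0)) := by
    have h1 := Finset.card_inter_add_card_sdiff u.val ({i, j, l}ᶜ : Finset (Fin n))
    rw [u.prop] at h1
    have h2 : u.val \ {i, j, l}ᶜ = {x ∈ ({i, j, l} : Finset (Fin n)) | x ∈ u.val} := by
      ext x
      simp only [Finset.mem_sdiff, Finset.mem_compl, not_not, Finset.mem_filter]
      exact and_comm
    rw [h2, Finset.card_filter, Finset.sum_insert (by simp [hij, hil]),
      Finset.sum_insert (by simp [hjl]), Finset.sum_singleton, ← add_assoc (ite _ _ _)] at h1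
    exact h1.symm
  have h1 := hcard s
  have h2 := hcard s'
  rw [h] at h2
  simp only [h, and_true, if_true]
  have key := sum_three_cycle_indicator_bool (i ∈ s.val) (j ∈ s.val) (l ∈ s.val) (i ∈ s'.val)
    (j ∈ s'.val) (l ∈ s'.val)
  simp only [decide_eq_true_eq, decide_eq_decide] at key
  exact key (by omega)

/-- The norm `1 + c + c²` of a three-cycle `c` maps the Specht module to its orthogonal complement,
provided that the tabloids are close to being square. The values of the norm of `x` are sums over
sets agreeing with a given one off the support of `c`; expanding the pairing with `y` in the
superset sums of `x` and `y`, every term has a factor at a set of fewer than `k` letters. -/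
theorem three_cycle_norm_mem_orthogonal (hnk : n < 2 * k + 3) {i j l : Fin n} (hij : i ≠ j)
    (hjl : j ≠ l) (hil : i ≠ l) {x : TabloidModule n k} (hx : x ∈ spechtSubmodule n k) :
    x + tabloidRep n k (Equiv.swap i j * Equiv.swap j l) x +
      tabloidRep n k (Equiv.swap i j * Equiv.swap i l) x ∈ spechtOrthogonal n k := by
  intro y hy
  set R : Finset (Fin n) := {i, j, l}ᶜ with hR
  have hRc : R.card = n - 3 := by
    rw [hR, Finset.card_compl, Fintype.card_fin,
      Finset.card_eq_three.2 ⟨i, j, l, hij, hil, hjl, rfl⟩]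
  have hval (s) : (x + tabloidRep n k (Equiv.swap i j * Equiv.swap j l) x +
      tabloidRep n k (Equiv.swap i j * Equiv.swap i l) x) s =
      ∑ T ∈ R.powerset with s.val ∩ R ⊆ T, supersetSum x T := by
    rw [← sum_inter_eq x Finset.inter_subset_right]
    simp only [Pi.add_apply, tabloidRep_apply]
    have : ∀ s', (if s'.val ∩ R = s.val ∩ R then x s' else 0) =
        (if s'.val ∩ R = s.val ∩ R then 1 else 0) * x s' := by
      intro s'
      split_ifs <;> simp
    rw [Finset.sum_congr rfl fun s' _ => (this s').trans
      (congrArg (· * x s') (sum_three_cycle_indicator hij hjl hil s s').symm)]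
    simp only [add_mul, ite_mul, one_mul, zero_mul, Finset.sum_add_distrib, Finset.sum_ite_eq',
      Finset.mem_univ, if_true]
  simp only [hval, Finset.sum_mul, Finset.sum_filter]
  rw [Finset.sum_comm]
  refine Finset.sum_eq_zero fun T hT => ?_
  rw [Finset.mem_powerset] at hT
  rcases lt_or_ge T.card k with hTk | hTk
  · simp [supersetSum_eq_zero hx hTk]
  have h0 : (∑ s : Set.powersetCard (Fin n) k, if s.val ∩ (R \ T) = ∅ then y s else 0) = 0 := by
    rw [sum_inter_eq y (Finset.empty_subset _)]
    refine Finset.sum_eq_zero fun P hP => supersetSum_eq_zero hy ?_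
    have h1 := Finset.card_le_card (Finset.mem_powerset.1 (Finset.mem_filter.1 hP).1)
    rw [Finset.card_sdiff_of_subset hT] at h1
    omega
  have hs (s : Set.powersetCard (Fin n) k) : s.val ∩ R ⊆ T ↔ s.val ∩ (R \ T) = ∅ := by
    rw [← Finset.inter_sdiff_assoc, Finset.sdiff_eq_empty_iff_subset]
  have hT0 := congrArg (supersetSum x T * ·) h0
  simp only [mul_zero, Finset.mul_sum] at hT0
  refine Eq.trans (Finset.sum_congr rfl fun s _ => ?_) hT0
  simp only [hs]
  split_ifs <;> simp

end TabloidSums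

/-- On `D^{(n-k,k)}` with `n < 2 * k + 3` the three-cycles satisfy `1 + c + c² = 0`. -/
theorem twoPartRep_three_cycle {n k : ℕ} (hnk : n < 2 * k + 3) {i j l : Fin n} (hij : i ≠ j)
    (hjl : j ≠ l) (hil : i ≠ l) (v : TwoPartModule n k) :
    v + twoPartRep n k (Equiv.swap i j * Equiv.swap j l) v +
      twoPartRep n k (Equiv.swap i j * Equiv.swap i l) v = 0 := by
  obtain ⟨x, rfl⟩ := Submodule.Quotient.mk_surjective _ v
  refine (Submodule.Quotient.mk_eq_zero (spechtRadical n k) (x := x +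
    spechtRep n k (Equiv.swap i j * Equiv.swap j l) x +
    spechtRep n k (Equiv.swap i j * Equiv.swap i l) x)).2 ?_
  exact three_cycle_norm_mem_orthogonal hnk hij hjl hil x.2

/-! ### Clifford operators -/

/-- The square of a sum of elements with square one and anticommutators one, split into two families
`x` and `y` because the factors act between two different modules. -/
theorem sum_mul_sum_of_anticommutator {E ι : Type*} [Ring E] [DecidableEq ι] (x y : ι → E)
    (S : Finset ι) (h1 : ∀ i ∈ S, x i * y i = 1)
    (h2 : ∀ i ∈ S, ∀ j ∈ S, i ≠ j → x i * y j + x j * y i = 1) :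
    (∑ i ∈ S, x i) * (∑ i ∈ S, y i) = ((S.card + 1).choose 2 : ℕ) := by
  induction S using Finset.induction_on with
  | empty => simp
  | insert a S ha ih =>
    have h3 : x a * (∑ i ∈ S, y i) + (∑ i ∈ S, x i) * y a = (S.card : E) := by
      rw [Finset.mul_sum, Finset.sum_mul, ← Finset.sum_add_distrib,
        Finset.sum_congr rfl fun j hj => h2 a (Finset.mem_insert_self a S) j
          (Finset.mem_insert_of_mem hj) (ne_of_mem_of_not_mem hj ha).symm]
      simp
    rw [Finset.sum_insert ha, Finset.sum_insert ha, Finset.card_insert_of_notMem ha,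
      Nat.choose_succ_succ' (S.card + 1) 1, Nat.choose_one_right, Nat.cast_add, Nat.cast_add,
      ← ih (fun i hi => h1 i (Finset.mem_insert_of_mem hi)) (fun i hi j hj => h2 i
        (Finset.mem_insert_of_mem hi) j (Finset.mem_insert_of_mem hj)), ← h3, Nat.cast_one,
      ← h1 a (Finset.mem_insert_self a S)]
    noncomm_ring

section Clifford

open Equiv Equiv.Perm

variable {V : Type*} [AddCommGroup V] [Module (ZMod 2) V] (ρ : Representation (ZMod 2) A9 V)

/-- The representation `ρ` of `A₉`, extended by zero to the odd permutations. -/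
def extendByZero (σ : Perm (Fin 9)) : Module.End (ZMod 2) V :=
  if h : sign σ = 1 then ρ ⟨σ, mem_alternatingGroup.2 h⟩ else 0

theorem extendByZero_coe (g : A9) : extendByZero ρ g = ρ g := by
  rw [extendByZero, dif_pos (mem_alternatingGroup.1 g.2)]

theorem extendByZero_of_sign_ne {σ : Perm (Fin 9)} (h : sign σ ≠ 1) : extendByZero ρ σ = 0 :=
  dif_neg h

theorem extendByZero_one : extendByZero ρ 1 = 1 := by
  rw [← map_one ρ, ← extendByZero_coe]
  rfl

theorem extendByZero_mul_left {σ : Perm (Fin 9)} (hσ : sign σ = 1) (π : Perm (Fin 9)) :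
    extendByZero ρ (σ * π) = extendByZero ρ σ * extendByZero ρ π := by
  by_cases hπ : sign π = 1
  · have hσπ : sign (σ * π) = 1 := by rw [Perm.sign_mul, hσ, hπ, one_mul]
    rw [extendByZero, extendByZero, extendByZero, dif_pos hσ, dif_pos hπ, dif_pos hσπ, ← map_mul]
    rfl
  · rw [extendByZero_of_sign_ne ρ hπ, mul_zero, extendByZero_of_sign_ne]
    rwa [Perm.sign_mul, hσ, one_mul]

theorem extendByZero_mul_right (σ : Perm (Fin 9)) {π : Perm (Fin 9)} (hπ : sign π = 1) :
    extendByZero ρ (σ * π) = extendByZero ρ σ * extendByZero ρ π := by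
  by_cases hσ : sign σ = 1
  · exact extendByZero_mul_left ρ hσ π
  · rw [extendByZero_of_sign_ne ρ hσ, zero_mul, extendByZero_of_sign_ne]
    rwa [Perm.sign_mul, hπ, mul_one]

/-- The relations `1 + c + c² = 0` for the three-cycles `c`, characteristic of spin modules in
characteristic two. -/
def HasSpinRelation : Prop :=
  ∀ i j l : Fin 9, i ≠ j → j ≠ l → i ≠ l →
    1 + extendByZero ρ (swap i j * swap j l) + extendByZero ρ (swap i j * swap i l) = 0

/-- The action of the vector `∑ i ∈ A, e i` on a spin module `V`, as a map from `V` to the twist of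
`V` by the transposition `(0 1)`; the vector `e i + e j` acts as the transposition `(i j)`. Only
sets `A` with an even number of elements are meaningful, and the base letter `0` serves to write
`∑ i ∈ A, e i` as `∑ i ∈ A, (e i + e 0)`; the term of `i = 0` vanishes, being the value of
`extendByZero` at an odd permutation. The operator on `V` results from identifying the spaces
underlying `V` and its twist by means of `(0 1)`. -/
def toTwist (A : Finset (Fin 9)) : Module.End (ZMod 2) V :=
  ∑ i ∈ A, extendByZero ρ (swap 0 1 * swap 0 i)

/-- The action of the vector `∑ i ∈ A, e i` on the twist of a spin module `V` by the transposition
`(0 1)`, as a map back to `V`; see `toTwist`. -/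
def ofTwist (A : Finset (Fin 9)) : Module.End (ZMod 2) V :=
  ∑ i ∈ A, extendByZero ρ (swap 0 i * swap 0 1)

variable {ρ}

theorem sign_swap_mul_swap {i j k l : Fin 9} (hij : i ≠ j) (hkl : k ≠ l) :
    sign (swap i j * swap k l) = 1 := by
  rw [Perm.sign_mul, sign_swap hij, sign_swap hkl]
  rfl

theorem sign_swap_mul_swap_self_ne {i j k : Fin 9} (hij : i ≠ j) :
    sign (swap i j * swap k k) ≠ 1 := by
  rw [Perm.sign_mul, sign_swap hij, swap_self]
  decide

theorem swap_mul_swap_rotate {a b c : Fin 9} (hac : a ≠ c) (hbc : b ≠ c) :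
    swap a b * swap b c = swap a c * swap a b := by
  rw [mul_swap_eq_swap_mul, swap_apply_right, swap_apply_of_ne_of_ne hac.symm hbc.symm]

/-- The vectors of the three transpositions of three letters have sum zero; here one letter is the
base letter `0`, and the letters need not be distinct. -/
theorem HasSpinRelation.add_right (h : HasSpinRelation ρ) (k l i j : Fin 9) (hkl : k ≠ l) :
    extendByZero ρ (swap k l * swap i j) =
      extendByZero ρ (swap k l * swap 0 i) + extendByZero ρ (swap k l * swap 0 j) := by
  have h0 (m : Fin 9) : extendByZero ρ (swap k l * swap m m) = 0 :=
    extendByZero_of_sign_ne ρ (sign_swap_mul_swap_self_ne hkl)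
  by_cases hij : i = j
  · rw [hij, h0, ZModModule.add_self]
  by_cases hi : i = 0
  · rw [hi, h0, zero_add]
  by_cases hj : j = 0
  · rw [hj, h0, add_zero, swap_comm i]
  have := congrArg (extendByZero ρ (swap k l * swap i j) * ·) (h i j 0 hij hj hi)
  simp only [mul_add, mul_one, mul_zero,
    ← extendByZero_mul_left ρ (sign_swap_mul_swap hkl hij)] at this
  rw [← mul_assoc, mul_assoc (swap k l), swap_mul_self, mul_one, ← mul_assoc,
    mul_assoc (swap k l), swap_mul_self, mul_one, add_assoc, ← ZModModule.sub_eq_add,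
    sub_eq_zero] at this
  rw [this, add_comm, swap_comm i, swap_comm j]

theorem HasSpinRelation.add_left (h : HasSpinRelation ρ) (i j k l : Fin 9) (hkl : k ≠ l) :
    extendByZero ρ (swap i j * swap k l) =
      extendByZero ρ (swap 0 i * swap k l) + extendByZero ρ (swap 0 j * swap k l) := by
  have h0 (m : Fin 9) : extendByZero ρ (swap m m * swap k l) = 0 := by
    refine extendByZero_of_sign_ne ρ ?_
    rw [Perm.sign_mul, mul_comm, ← Perm.sign_mul]
    exact sign_swap_mul_swap_self_ne hkl
  by_cases hij : i = j
  · rw [hij, h0, ZModModule.add_self]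
  by_cases hi : i = 0
  · rw [hi, h0, zero_add]
  by_cases hj : j = 0
  · rw [hj, h0, add_zero, swap_comm i]
  have := congrArg (· * extendByZero ρ (swap i j * swap k l))
    (h 0 i j (Ne.symm hi) hij (Ne.symm hj))
  simp only [add_mul, one_mul, zero_mul,
    ← extendByZero_mul_right ρ _ (sign_swap_mul_swap hij hkl)] at this
  rw [show swap 0 i * swap i j * (swap i j * swap k l) = swap 0 i * swap k l by
      rw [mul_assoc, ← mul_assoc (swap i j), swap_mul_self, one_mul],
    show swap 0 i * swap 0 j * (swap i j * swap k l) = swap 0 j * swap k l by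
      rw [← swap_mul_swap_rotate (Ne.symm hi) (Ne.symm hij), swap_comm j i, mul_assoc,
        ← mul_assoc (swap i j), swap_mul_self, one_mul], add_assoc, ← ZModModule.sub_eq_add,
    sub_eq_zero] at this
  exact this

theorem toTwist_pair (h : HasSpinRelation ρ) {i j : Fin 9} (hij : i ≠ j) :
    toTwist ρ {i, j} = extendByZero ρ (swap 0 1 * swap i j) := by
  rw [toTwist, Finset.sum_pair hij, h.add_right 0 1 i j (by decide)]

theorem ofTwist_pair (h : HasSpinRelation ρ) {i j : Fin 9} (hij : i ≠ j) :
    ofTwist ρ {i, j} = extendByZero ρ (swap i j * swap 0 1) := by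
  rw [ofTwist, Finset.sum_pair hij, h.add_left i j 0 1 (by decide)]

theorem sum_symmDiff_of_char_two {E ι : Type*} [AddCommGroup E] [Module (ZMod 2) E]
    [DecidableEq ι] (f : ι → E) (A B : Finset ι) :
    ∑ i ∈ symmDiff A B, f i = ∑ i ∈ A, f i + ∑ i ∈ B, f i := by
  rw [Finset.symmDiff_def, Finset.sum_union (Finset.disjoint_left.2 fun x => by simp; tauto),
    ← Finset.sum_inter_add_sum_sdiff A B f, ← Finset.sum_inter_add_sum_sdiff B A f,
    Finset.inter_comm B A]
  rw [add_add_add_comm, ZModModule.add_self, zero_add]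

theorem toTwist_symmDiff (A B : Finset (Fin 9)) :
    toTwist ρ (symmDiff A B) = toTwist ρ A + toTwist ρ B :=
  sum_symmDiff_of_char_two _ A B

theorem ofTwist_symmDiff (A B : Finset (Fin 9)) :
    ofTwist ρ (symmDiff A B) = ofTwist ρ A + ofTwist ρ B :=
  sum_symmDiff_of_char_two _ A B

/-- The base letter contributes nothing to `toTwist` and `ofTwist`, and an even set with `2 * m`
elements has either `2 * m` or `2 * m - 1` other elements. -/
theorem sum_mul_sum_of_even {x y : Fin 9 → Module.End (ZMod 2) V} (hx : x 0 = 0)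
    (hy : y 0 = 0) (h1 : ∀ i, i ≠ 0 → x i * y i = 1)
    (h2 : ∀ i j, i ≠ 0 → j ≠ 0 → i ≠ j → x i * y j + x j * y i = 1) {A : Finset (Fin 9)} {m : ℕ}
    (hA : A.card = 2 * m) : (∑ i ∈ A, x i) * (∑ i ∈ A, y i) = m := by
  have hcast (a b : ℕ) : ((2 * a + b : ℕ) : Module.End (ZMod 2) V) = b := by
    rw [Nat.cast_add, Nat.cast_mul, Nat.cast_two, two_mul, ZModModule.add_self, zero_add]
  rw [← Finset.sum_erase A hx, ← Finset.sum_erase A hy, sum_mul_sum_of_anticommutator x y _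
    (fun i hi => h1 i (Finset.ne_of_mem_erase hi))
    (fun i hi j hj => h2 i j (Finset.ne_of_mem_erase hi) (Finset.ne_of_mem_erase hj))]
  by_cases h0 : 0 ∈ A
  · rw [Finset.card_erase_add_one h0, hA, ← hcast (m * (m - 1)) m]
    congr 1
    rw [Nat.choose_two_right]
    cases m with
    | zero => rfl
    | succ m =>
      rw [Nat.add_sub_cancel, mul_assoc, Nat.mul_div_cancel_left _ (by norm_num)]
      rw [show 2 * (m + 1) - 1 = 2 * m + 1 by omega]
      ring
  · rw [Finset.erase_eq_of_notMem h0, hA, ← hcast (m * m) m, Nat.choose_two_right,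
      Nat.add_sub_cancel, mul_comm (2 * m + 1), mul_assoc, Nat.mul_div_cancel_left _ (by norm_num)]
    congr 1
    ring

/-- The Clifford relation: a vector of weight `2 * m` squares to `m`. -/
theorem ofTwist_mul_toTwist (h : HasSpinRelation ρ) {A : Finset (Fin 9)} {m : ℕ}
    (hA : A.card = 2 * m) : ofTwist ρ A * toTwist ρ A = m := by
  have hmul (i j : Fin 9) (hi : i ≠ 0) :
      extendByZero ρ (swap 0 i * swap 0 1) * extendByZero ρ (swap 0 1 * swap 0 j) =
        extendByZero ρ (swap 0 i * swap 0 j) := by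
    rw [← extendByZero_mul_left ρ (sign_swap_mul_swap hi.symm (by decide)), ← mul_assoc,
      mul_assoc (swap 0 i), swap_mul_self, mul_one]
  refine sum_mul_sum_of_even (extendByZero_of_sign_ne ρ ?_) (extendByZero_of_sign_ne ρ ?_) ?_ ?_ hA
  · decide
  · decide
  · intro i hi
    rw [hmul i i hi, swap_mul_self, extendByZero_one]
  · intro i j hi hj hij
    rw [hmul i j hi, hmul j i hj]
    rw [← swap_mul_swap_rotate hj.symm hij, ← sub_eq_zero, ZModModule.sub_eq_add, ← h 0 i j hi.symm
      hij hj.symm]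
    abel

theorem toTwist_mul_ofTwist (h : HasSpinRelation ρ) {A : Finset (Fin 9)} {m : ℕ}
    (hA : A.card = 2 * m) : toTwist ρ A * ofTwist ρ A = m := by
  have hmul (i j : Fin 9) (hi : i ≠ 0) :
      extendByZero ρ (swap 0 1 * swap 0 i) * extendByZero ρ (swap 0 j * swap 0 1) =
        extendByZero ρ (swap (swap 0 1 0) (swap 0 1 i) * swap (swap 0 1 0) (swap 0 1 j)) := by
    rw [← extendByZero_mul_left ρ (sign_swap_mul_swap (by decide) hi.symm), mul_swap_eq_swap_mul,
      mul_assoc, ← mul_assoc (swap 0 1) (swap 0 j), mul_swap_eq_swap_mul (swap 0 1) 0 j, mul_assoc,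
      swap_mul_self, mul_one]
  have hinj {i j : Fin 9} (hij : i ≠ j) : swap (0 : Fin 9) 1 i ≠ swap 0 1 j :=
    fun h' => hij ((swap 0 1).injective h')
  refine sum_mul_sum_of_even (extendByZero_of_sign_ne ρ ?_) (extendByZero_of_sign_ne ρ ?_) ?_ ?_ hA
  · decide
  · decide
  · intro i hi
    rw [hmul i i hi, swap_mul_self, extendByZero_one]
  · intro i j hi hj hij
    rw [hmul i j hi, hmul j i hj]
    rw [← swap_mul_swap_rotate (hinj hj.symm) (hinj hij), ← sub_eq_zero, ZModModule.sub_eq_add,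
      ← h _ _ _ (hinj hi.symm) (hinj hij) (hinj hj.symm)]
    abel

/-- The action of even permutations on vectors. -/
theorem toTwist_map_mul (h : HasSpinRelation ρ) {A : Finset (Fin 9)} (hA : Even A.card)
    {σ : Perm (Fin 9)} (hσ : sign σ = 1) :
    toTwist ρ (A.map σ.toEmbedding) * extendByZero ρ σ =
      extendByZero ρ (swap 0 1 * σ * swap 0 1) * toTwist ρ A := by
  have hτσ : sign (swap 0 1 * σ * swap 0 1) = 1 := by
    rw [Perm.sign_mul, mul_comm, ← Perm.sign_mul, ← mul_assoc, swap_mul_self, one_mul, hσ]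
  have hi (i : Fin 9) : extendByZero ρ (swap 0 1 * swap 0 (σ i)) * extendByZero ρ σ =
      extendByZero ρ (swap 0 1 * σ * swap 0 1) * (extendByZero ρ (swap 0 1 * swap 0 (σ⁻¹ 0)) +
        extendByZero ρ (swap 0 1 * swap 0 i)) := by
    rw [← h.add_right 0 1 _ _ (by decide), ← extendByZero_mul_right ρ _ hσ,
      ← extendByZero_mul_left ρ hτσ]
    congr 1
    rw [mul_assoc (swap 0 1 * σ), ← mul_assoc (swap 0 1) (swap 0 1), swap_mul_self, one_mul,
      mul_assoc (swap 0 1) σ, mul_swap_eq_swap_mul σ,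
      show σ (σ⁻¹ 0) = 0 from σ.apply_symm_apply 0, mul_assoc]
  simp only [toTwist, Finset.sum_map, coe_toEmbedding, Finset.sum_mul, hi]
  rw [← Finset.mul_sum, Finset.sum_add_distrib, Finset.sum_const, ← Nat.cast_smul_eq_nsmul (ZMod 2),
    (ZMod.natCast_eq_zero_iff_even).2 hA, zero_smul, zero_add]


theorem natCast_two_mul_eq_zero (m : ℕ) : ((2 * m : ℕ) : Module.End (ZMod 2) V) = 0 := by
  rw [Nat.cast_mul, Nat.cast_two, two_mul, ZModModule.add_self]

theorem ofTwist_mul_toTwist_eq_zero (h : HasSpinRelation ρ) {A : Finset (Fin 9)}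
    (hA : A.card % 4 = 0) : ofTwist ρ A * toTwist ρ A = 0 := by
  rw [ofTwist_mul_toTwist h (m := 2 * (A.card / 4)) (by omega), natCast_two_mul_eq_zero]

theorem toTwist_mul_ofTwist_eq_zero (h : HasSpinRelation ρ) {A : Finset (Fin 9)}
    (hA : A.card % 4 = 0) : toTwist ρ A * ofTwist ρ A = 0 := by
  rw [toTwist_mul_ofTwist h (m := 2 * (A.card / 4)) (by omega), natCast_two_mul_eq_zero]

theorem ofTwist_mul_toTwist_eq_one (h : HasSpinRelation ρ) {A : Finset (Fin 9)}
    (hA : A.card % 4 = 2) : ofTwist ρ A * toTwist ρ A = 1 := by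
  rw [ofTwist_mul_toTwist h (m := 2 * (A.card / 4) + 1) (by omega), Nat.cast_add,
    natCast_two_mul_eq_zero, Nat.cast_one, zero_add]

theorem toTwist_mul_ofTwist_eq_one (h : HasSpinRelation ρ) {A : Finset (Fin 9)}
    (hA : A.card % 4 = 2) : toTwist ρ A * ofTwist ρ A = 1 := by
  rw [toTwist_mul_ofTwist h (m := 2 * (A.card / 4) + 1) (by omega), Nat.cast_add,
    natCast_two_mul_eq_zero, Nat.cast_one, zero_add]

theorem ofTwist_mul_toTwist_symmDiff (A B : Finset (Fin 9)) :
    ofTwist ρ (symmDiff A B) * toTwist ρ (symmDiff A B) = ofTwist ρ A * toTwist ρ A +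
      (ofTwist ρ A * toTwist ρ B + ofTwist ρ B * toTwist ρ A) + ofTwist ρ B * toTwist ρ B := by
  rw [ofTwist_symmDiff, toTwist_symmDiff]
  noncomm_ring

theorem ofTwist_pair_mul_toTwist_pair (h : HasSpinRelation ρ) {i j k l : Fin 9} (hij : i ≠ j)
    (hkl : k ≠ l) : ofTwist ρ {i, j} * toTwist ρ {k, l} =
      extendByZero ρ (swap i j * swap k l) := by
  rw [ofTwist_pair h hij, toTwist_pair h hkl,
    ← extendByZero_mul_left ρ (sign_swap_mul_swap hij (by decide)), ← mul_assoc,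
    mul_assoc (swap i j), swap_mul_self, mul_one]

/-! ### The spread -/

variable (ρ) in
/-- The vectors annihilated by the singular vector `∑ i ≠ a, e i`, which is fixed by the stabilizer
of the letter `a`. -/
def spreadMember (a : Fin 9) : Submodule (ZMod 2) V :=
  LinearMap.ker (toTwist ρ (Finset.univ.erase a))

theorem mem_spreadMember {a : Fin 9} {v : V} :
    v ∈ spreadMember ρ a ↔ toTwist ρ (Finset.univ.erase a) v = 0 := LinearMap.mem_ker

theorem card_univ_erase (a : Fin 9) : (Finset.univ.erase a).card = 8 := by
  rw [Finset.card_erase_of_mem (Finset.mem_univ a), Finset.card_univ, Fintype.card_fin]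

theorem ofTwist_apply_mem_spreadMember (h : HasSpinRelation ρ) (a : Fin 9) (v : V) :
    ofTwist ρ (Finset.univ.erase a) v ∈ spreadMember ρ a := by
  rw [mem_spreadMember, ← Module.End.mul_apply,
    toTwist_mul_ofTwist_eq_zero h (by rw [card_univ_erase]), LinearMap.zero_apply]

/-- The singular vectors belonging to two letters form a hyperbolic pair. -/
theorem ofTwist_erase_anticommutator (h : HasSpinRelation ρ) {a b : Fin 9} (hab : a ≠ b) (v : V) :
    ofTwist ρ (Finset.univ.erase a) (toTwist ρ (Finset.univ.erase b) v) +
      ofTwist ρ (Finset.univ.erase b) (toTwist ρ (Finset.univ.erase a) v) = v := by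
  have hcard : ∀ a b : Fin 9, a ≠ b →
      (symmDiff (Finset.univ.erase a) (Finset.univ.erase b)).card % 4 = 2 := by decide
  have := ofTwist_mul_toTwist_symmDiff (ρ := ρ) (Finset.univ.erase a) (Finset.univ.erase b)
  rw [ofTwist_mul_toTwist_eq_one h (hcard a b hab),
    ofTwist_mul_toTwist_eq_zero h (by rw [card_univ_erase]),
    ofTwist_mul_toTwist_eq_zero h (by rw [card_univ_erase]), zero_add, add_zero] at this
  simpa using (LinearMap.congr_fun this v).symm

theorem isCompl_spreadMember (h : HasSpinRelation ρ) {a b : Fin 9} (hab : a ≠ b) :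
    IsCompl (spreadMember ρ a) (spreadMember ρ b) := by
  constructor
  · rw [Submodule.disjoint_def]
    intro v ha hb
    rw [← ofTwist_erase_anticommutator h hab v, mem_spreadMember.1 ha, mem_spreadMember.1 hb]
    simp
  · rw [codisjoint_iff, eq_top_iff]
    intro v _
    rw [← ofTwist_erase_anticommutator h hab v]
    exact Submodule.add_mem_sup (ofTwist_apply_mem_spreadMember h a _)
      (ofTwist_apply_mem_spreadMember h b _)

theorem exists_ofTwist_of_mem_spreadMember (h : HasSpinRelation ρ) {a : Fin 9} {u : V}
    (hu : u ∈ spreadMember ρ a) : ∃ v, ofTwist ρ (Finset.univ.erase a) v = u := by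
  obtain ⟨b, hb⟩ := exists_ne a
  refine ⟨toTwist ρ (Finset.univ.erase b) u, ?_⟩
  have := ofTwist_erase_anticommutator h hb.symm u
  rwa [mem_spreadMember.1 hu, map_zero, add_zero] at this

theorem finrank_spreadMember (h : HasSpinRelation ρ) (hdim : finrank (ZMod 2) V = 8) (a : Fin 9) :
    finrank (ZMod 2) (spreadMember ρ a) = 4 := by
  have : FiniteDimensional (ZMod 2) V := Module.finite_of_finrank_pos (by omega)
  have hsum {b c : Fin 9} (hbc : b ≠ c) :=
    Submodule.finrank_add_eq_of_isCompl (isCompl_spreadMember h hbc)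
  obtain ⟨b, c, hab, hac, hbc⟩ : ∃ b c, a ≠ b ∧ a ≠ c ∧ b ≠ c := by
    revert a
    decide
  have h1 := hsum hab
  have h2 := hsum hac
  have h3 := hsum hbc
  omega

theorem apply_mem_spreadMember (h : HasSpinRelation ρ) (g : A9) {a : Fin 9} {v : V}
    (hv : v ∈ spreadMember ρ a) : ρ g v ∈ spreadMember ρ (g • a) := by
  have hmap : (Finset.univ.erase a).map (g : Perm (Fin 9)).toEmbedding =
      Finset.univ.erase (g • a) := by
    rw [Finset.map_erase, Finset.map_univ_equiv]
    rfl
  have := toTwist_map_mul h (A := Finset.univ.erase a) (by rw [card_univ_erase]; decide)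
    (mem_alternatingGroup.1 g.2)
  rw [hmap, extendByZero_coe] at this
  rw [mem_spreadMember, ← Module.End.mul_apply, this, Module.End.mul_apply, mem_spreadMember.1 hv,
    map_zero]

theorem map_spreadMember (h : HasSpinRelation ρ) (g : A9) (a : Fin 9) :
    (spreadMember ρ a).map (ρ g) = spreadMember ρ (g • a) := by
  apply le_antisymm
  · rw [Submodule.map_le_iff_le_comap]
    exact fun v hv => apply_mem_spreadMember h g hv
  · intro v hv
    refine ⟨ρ g⁻¹ v, ?_, by simp⟩
    simpa using apply_mem_spreadMember h g⁻¹ hv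

end Clifford

/-! ### Irreducible submodules for the stabilizer of a letter -/

section Dimension

variable {W : Type*} [AddCommGroup W] [Module (ZMod 2) W]

theorem apply_ne_self_of_one_add_add_sq {c : Module.End (ZMod 2) W} (hc : 1 + c + c * c = 0) {w : W}
    (h : c w = w) : w = 0 := by
  have := LinearMap.congr_fun hc w
  simpa [h, ZModModule.add_self] using this

/-- The operator `c` has order three and fixes no nonzero vector, hence `2 ^ dim W ≡ 1` modulo
three. -/
theorem even_finrank_of_one_add_add_sq [FiniteDimensional (ZMod 2) W] {c : Module.End (ZMod 2) W}
    (hc : 1 + c + c * c = 0) : Even (finrank (ZMod 2) W) := by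
  classical
  have : Finite W := Module.finite_of_finite (ZMod 2)
  have : Fintype W := Fintype.ofFinite W
  have hc3 : c * (c * c) = 1 := by
    have h1 := congrArg (c * ·) hc
    simp only [mul_add, mul_one, mul_zero] at h1
    have h2 : c * (c * c) = c + c * c + c * (c * c) + (c + c * c) := by
      rw [add_right_comm, ZModModule.add_self, zero_add]
    rw [h2, h1, zero_add, ← sub_eq_zero, ZModModule.sub_eq_add, ← hc]
    abel
  have key := Equiv.Perm.card_fixedPoints_modEq (α := W) (f := (c : W → W)) (p := 3) (n := 1) (by
    funext w
    exact LinearMap.congr_fun hc3 w)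
  have hfix : Fintype.card (Function.fixedPoints (c : W → W)) = 1 := by
    rw [Fintype.card_eq_one_iff]
    refine ⟨⟨0, map_zero c⟩, fun w => Subtype.ext ?_⟩
    exact apply_ne_self_of_one_add_add_sq hc w.2
  rw [hfix, Module.card_eq_pow_finrank (K := ZMod 2), ZMod.card] at key
  by_contra hodd
  obtain ⟨m, hm⟩ := Nat.not_even_iff_odd.1 hodd
  rw [hm, pow_succ, pow_mul] at key
  have h4 : (2 ^ 2) ^ m * 2 ≡ 1 ^ m * 2 [MOD 3] := Nat.ModEq.mul_right _ (Nat.ModEq.pow m rfl)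
  have := h4.symm.trans key
  rw [one_pow] at this
  exact absurd this (by decide)

theorem add_mul_add_of_commuting {c d : Module.End (ZMod 2) W} (hc : 1 + c + c * c = 0)
    (hd : 1 + d + d * d = 0) (hcd : c * d = d * c) : (c + d) * (c + d) = c + d := by
  have hcc : c * c = c + 1 := by
    rw [← sub_eq_zero, ZModModule.sub_eq_add, ← hc]; abel
  have hdd : d * d = d + 1 := by
    rw [← sub_eq_zero, ZModModule.sub_eq_add, ← hd]; abel
  rw [add_mul, mul_add, mul_add, hcc, hdd, ← hcd, ← sub_eq_zero, ZModModule.sub_eq_add]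
  have h1 := ZModModule.add_self (c * d)
  have h2 := ZModModule.add_self c
  have h3 := ZModModule.add_self d
  have h4 := ZModModule.add_self (1 : Module.End (ZMod 2) W)
  calc _ = (c * d + c * d) + (c + c) + (d + d) + (1 + 1) := by abel
    _ = 0 := by rw [h1, h2, h3, h4]; simp

/-- The operator `c + d` is an idempotent commuting with `c` and conjugate to its complement, so
that both its kernel and its range are spaces over the field with four elements, of equal
dimension. -/
theorem four_dvd_finrank_of_commuting [FiniteDimensional (ZMod 2) W]
    {c d g : Module.End (ZMod 2) W} (hc : 1 + c + c * c = 0) (hd : 1 + d + d * d = 0)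
    (hcd : c * d = d * c) (hgc : g * c = c * g) (hgd : g * d = (d + 1) * g)
    (hg : Function.Injective g) : 4 ∣ finrank (ZMod 2) W := by
  set p := c + d with hp
  have hpp : p * p = p := add_mul_add_of_commuting hc hd hcd
  have hgp : g * p = (p + 1) * g := by
    rw [hp, mul_add, hgc, hgd, ← add_mul, add_assoc]
  have hgp' : g * (p + 1) = p * g := by
    rw [mul_add, hgp, add_mul, mul_one, one_mul, add_assoc, ZModModule.add_self, add_zero]
  have hcompl : IsCompl (LinearMap.ker p) (LinearMap.ker (p + 1)) := by
    constructor
    · rw [Submodule.disjoint_def]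
      intro w h1 h2
      simpa [LinearMap.mem_ker.1 h1] using h2
    · rw [codisjoint_iff, eq_top_iff]
      intro w _
      have : w = (p + 1) w + p w := by
        rw [LinearMap.add_apply, add_right_comm, ZModModule.add_self]; simp
      rw [this]
      refine Submodule.add_mem_sup ?_ ?_
      · rw [LinearMap.mem_ker, ← Module.End.mul_apply, mul_add, hpp, mul_one, ZModModule.add_self,
          LinearMap.zero_apply]
      · rw [LinearMap.mem_ker, ← Module.End.mul_apply, add_mul, hpp, one_mul, ZModModule.add_self,
          LinearMap.zero_apply]
  have hle {K L : Submodule (ZMod 2) W} (hKL : ∀ w ∈ K, g w ∈ L) :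
      finrank (ZMod 2) K ≤ finrank (ZMod 2) L := by
    rw [(Submodule.equivMapOfInjective g hg K).finrank_eq]
    exact Submodule.finrank_mono (Submodule.map_le_iff_le_comap.2 hKL)
  have h1 : finrank (ZMod 2) (LinearMap.ker p) ≤ finrank (ZMod 2) (LinearMap.ker (p + 1)) :=
    hle fun w hw => by
      rw [LinearMap.mem_ker, ← Module.End.mul_apply, ← hgp, Module.End.mul_apply,
        LinearMap.mem_ker.1 hw, map_zero]
  have h2 : finrank (ZMod 2) (LinearMap.ker (p + 1)) ≤ finrank (ZMod 2) (LinearMap.ker p) :=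
    hle fun w hw => by
      rw [LinearMap.mem_ker, ← Module.End.mul_apply, ← hgp', Module.End.mul_apply,
        LinearMap.mem_ker.1 hw, map_zero]
  have hcp (w : W) (hw : w ∈ LinearMap.ker p) : c w ∈ LinearMap.ker p := by
    rw [LinearMap.mem_ker, ← Module.End.mul_apply, hp, add_mul, ← hcd, ← mul_add, ← hp,
      Module.End.mul_apply, LinearMap.mem_ker.1 hw, map_zero]
  have heven : Even (finrank (ZMod 2) (LinearMap.ker p)) := by
    refine even_finrank_of_one_add_add_sq (c := c.restrict hcp) (LinearMap.ext fun w => ?_)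
    exact Subtype.ext (LinearMap.congr_fun hc w)
  have hsum := Submodule.finrank_add_eq_of_isCompl hcompl
  obtain ⟨m, hm⟩ := heven
  omega

end Dimension

section Clifford

open Equiv Equiv.Perm

variable {V : Type*} [AddCommGroup V] [Module (ZMod 2) V] {ρ : Representation (ZMod 2) A9 V}

theorem extendByZero_swap_mul_swap_mem {a : Fin 9}
    (U : Subrepresentation (ρ.comp (A8 a).subtype)) {i j k l : Fin 9} (hi : i ≠ a) (hj : j ≠ a)
    (hk : k ≠ a) (hl : l ≠ a) {u : V} (hu : u ∈ U.toSubmodule) :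
    extendByZero ρ (swap i j * swap k l) u ∈ U.toSubmodule := by
  rw [extendByZero]
  split_ifs with hs
  · refine U.apply_mem_toSubmodule ⟨⟨swap i j * swap k l, mem_alternatingGroup.2 hs⟩, ?_⟩ hu
    change swap i j (swap k l a) = a
    rw [swap_apply_of_ne_of_ne hk.symm hl.symm, swap_apply_of_ne_of_ne hi.symm hj.symm]
  · exact U.toSubmodule.zero_mem

/-- Let `z = ∑ i ≠ a, e i` and let `r` be the vector of a transposition of two letters other than
`a`. The operator `z * r` is a sum of four elements of the stabilizer of `a`, its range is
contained in `spreadMember ρ a`, and its kernel is `spreadMember ρ a` because `z` and `r` commute.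
-/
theorem le_spreadMember (h : HasSpinRelation ρ) {a : Fin 9}
    (U : Subrepresentation (ρ.comp (A8 a).subtype)) (hU : U.toRepresentation.IsIrreducible) :
    U.toSubmodule ≤ spreadMember ρ a := by
  let W : Subrepresentation U.toRepresentation :=
    { toSubmodule := (spreadMember ρ a).comap U.toSubmodule.subtype
      apply_mem_toSubmodule := by
        intro g v hv
        have := apply_mem_spreadMember h (g : A9) (a := a) (v := v) hv
        rw [show (g : A9) • a = a from g.2] at this
        exact this }
  rcases eq_bot_or_eq_top W with hW | hW
  swap
  · intro u hu
    have : (⟨u, hu⟩ : U.toSubmodule) ∈ W.toSubmodule := by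
      rw [hW]
      exact Submodule.mem_top
    exact this
  have hbot (u : V) (hu : u ∈ U.toSubmodule) (hua : u ∈ spreadMember ρ a) : u = 0 := by
    have : (⟨u, hu⟩ : U.toSubmodule) ∈ W.toSubmodule := hua
    rw [hW] at this
    exact congrArg Subtype.val ((Submodule.mem_bot _).1 this)
  intro u hu
  let b : Fin 8 → Fin 9 := a.succAbove
  have hba (i : Fin 8) : b i ≠ a := Fin.succAbove_ne a i
  have hb {i j : Fin 8} (hij : i ≠ j) : b i ≠ b j := Fin.succAbove_right_injective.ne hij
  have hz : ∀ a : Fin 9, Finset.univ.erase a =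
      symmDiff (symmDiff {a.succAbove 0, a.succAbove 1} {a.succAbove 2, a.succAbove 3})
        (symmDiff {a.succAbove 4, a.succAbove 5} {a.succAbove 6, a.succAbove 7}) := by decide
  have hzr : ∀ a : Fin 9, (symmDiff (Finset.univ.erase a)
      {a.succAbove 0, a.succAbove 1}).card % 4 = 2 := by decide
  have hr : ofTwist ρ {b 0, b 1} * toTwist ρ {b 0, b 1} = 1 :=
    ofTwist_mul_toTwist_eq_one h (by rw [Finset.card_pair (hb (by decide))])
  have hmem : ofTwist ρ (Finset.univ.erase a) (toTwist ρ {b 0, b 1} u) ∈ U.toSubmodule := by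
    rw [hz, ofTwist_symmDiff, ofTwist_symmDiff, ofTwist_symmDiff, ← Module.End.mul_apply, add_mul,
      add_mul, add_mul]
    rw [ofTwist_pair_mul_toTwist_pair h (hb (by decide)) (hb (by decide)),
      ofTwist_pair_mul_toTwist_pair h (hb (by decide)) (hb (by decide)),
      ofTwist_pair_mul_toTwist_pair h (hb (by decide)) (hb (by decide)),
      ofTwist_pair_mul_toTwist_pair h (hb (by decide)) (hb (by decide))]
    have hm (i j k l : Fin 8) := extendByZero_swap_mul_swap_mem U (hba i) (hba j) (hba k) (hba l) hu
    exact add_mem (add_mem (hm _ _ _ _) (hm _ _ _ _)) (add_mem (hm _ _ _ _) (hm _ _ _ _))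
  have h0 := hbot _ hmem (ofTwist_apply_mem_spreadMember h a _)
  have hcomm := ofTwist_mul_toTwist_symmDiff (ρ := ρ) (Finset.univ.erase a) {b 0, b 1}
  rw [ofTwist_mul_toTwist_eq_one h (hzr a), hr,
    ofTwist_mul_toTwist_eq_zero h (by rw [card_univ_erase]), zero_add] at hcomm
  have h1 := LinearMap.congr_fun (right_eq_add.1 hcomm) u
  rw [LinearMap.add_apply, Module.End.mul_apply, Module.End.mul_apply, h0, zero_add,
    LinearMap.zero_apply] at h1
  have hr' : toTwist ρ {b 0, b 1} * ofTwist ρ {b 0, b 1} = 1 :=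
    toTwist_mul_ofTwist_eq_one h (by rw [Finset.card_pair (hb (by decide))])
  have h2 := LinearMap.congr_fun hr' (toTwist ρ (Finset.univ.erase a) u)
  rwa [Module.End.mul_apply, h1, map_zero, Module.End.one_apply, eq_comm] at h2

theorem HasSpinRelation.three_cycle (h : HasSpinRelation ρ) {i j l : Fin 9} (hij : i ≠ j)
    (hjl : j ≠ l) (hil : i ≠ l) :
    1 + extendByZero ρ (swap i j * swap j l) +
      extendByZero ρ (swap i j * swap j l) * extendByZero ρ (swap i j * swap j l) = 0 := by
  rw [← extendByZero_mul_left ρ (sign_swap_mul_swap hij hjl), ← h i j l hij hjl hil]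
  congr 2
  rw [mul_assoc, ← mul_assoc (swap j l), swap_comm j l, swap_comm i j,
    swap_mul_swap_rotate hil.symm hij.symm, mul_assoc, swap_mul_self, mul_one, swap_comm l i]

theorem extendByZero_mul_comm {i j k l : Fin 9} (hij : i ≠ j) (hkl : k ≠ l) {i' j' k' l' : Fin 9}
    (hij' : i' ≠ j') (hkl' : k' ≠ l')
    (hcomm : (swap i j * swap k l) * (swap i' j' * swap k' l') =
      (swap i' j' * swap k' l') * (swap i j * swap k l)) :
    extendByZero ρ (swap i j * swap k l) * extendByZero ρ (swap i' j' * swap k' l') =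
      extendByZero ρ (swap i' j' * swap k' l') * extendByZero ρ (swap i j * swap k l) := by
  rw [← extendByZero_mul_left ρ (sign_swap_mul_swap hij hkl),
    ← extendByZero_mul_left ρ (sign_swap_mul_swap hij' hkl'), hcomm]

theorem HasSpinRelation.inverse_eq (h : HasSpinRelation ρ) {i j l : Fin 9} (hij : i ≠ j)
    (hjl : j ≠ l) (hil : i ≠ l) :
    extendByZero ρ (swap i j * swap i l) = extendByZero ρ (swap i j * swap j l) + 1 := by
  rw [← sub_eq_zero, ZModModule.sub_eq_add, ← h i j l hij hjl hil]
  abel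

/-- A permutation that inverts a three-cycle `c` conjugates its operator to `c + 1 = c²`. -/
theorem HasSpinRelation.mul_of_invert (h : HasSpinRelation ρ) {i j l : Fin 9} (hij : i ≠ j)
    (hjl : j ≠ l) (hil : i ≠ l) {i' j' k' l' : Fin 9} (hij' : i' ≠ j') (hkl' : k' ≠ l')
    (hinv : (swap i' j' * swap k' l') * (swap i j * swap j l) =
      (swap i j * swap i l) * (swap i' j' * swap k' l')) :
    extendByZero ρ (swap i' j' * swap k' l') * extendByZero ρ (swap i j * swap j l) =
      (extendByZero ρ (swap i j * swap j l) + 1) *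
        extendByZero ρ (swap i' j' * swap k' l') := by
  rw [← extendByZero_mul_left ρ (sign_swap_mul_swap hij' hkl'), hinv,
    extendByZero_mul_left ρ (sign_swap_mul_swap hij hil), h.inverse_eq hij hjl hil]

/-- Two disjoint three-cycles of letters other than `a`, and an involution inverting only the second
of them, restrict to `U`. -/
theorem HasSpinRelation.four_dvd_finrank [FiniteDimensional (ZMod 2) V] (h : HasSpinRelation ρ)
    {a : Fin 9} (U : Subrepresentation (ρ.comp (A8 a).subtype)) :
    4 ∣ finrank (ZMod 2) U.toSubmodule := by
  let b : Fin 8 → Fin 9 := a.succAbove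
  have hba (i : Fin 8) : b i ≠ a := Fin.succAbove_ne a i
  have hb {i j : Fin 8} (hij : i ≠ j) : b i ≠ b j := Fin.succAbove_right_injective.ne hij
  have hmem (i j k l : Fin 8) (u : V) (hu : u ∈ U.toSubmodule) :=
    extendByZero_swap_mul_swap_mem U (hba i) (hba j) (hba k) (hba l) hu
  have hcd : ∀ a : Fin 9,
      (swap (a.succAbove 0) (a.succAbove 1) * swap (a.succAbove 1) (a.succAbove 2)) *
        (swap (a.succAbove 3) (a.succAbove 4) * swap (a.succAbove 4) (a.succAbove 5)) =
      (swap (a.succAbove 3) (a.succAbove 4) * swap (a.succAbove 4) (a.succAbove 5)) *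
        (swap (a.succAbove 0) (a.succAbove 1) * swap (a.succAbove 1) (a.succAbove 2)) := by
    decide
  have hgc : ∀ a : Fin 9,
      (swap (a.succAbove 3) (a.succAbove 4) * swap (a.succAbove 6) (a.succAbove 7)) *
        (swap (a.succAbove 0) (a.succAbove 1) * swap (a.succAbove 1) (a.succAbove 2)) =
      (swap (a.succAbove 0) (a.succAbove 1) * swap (a.succAbove 1) (a.succAbove 2)) *
        (swap (a.succAbove 3) (a.succAbove 4) * swap (a.succAbove 6) (a.succAbove 7)) := by
    decide
  have hgd : ∀ a : Fin 9,
      (swap (a.succAbove 3) (a.succAbove 4) * swap (a.succAbove 6) (a.succAbove 7)) *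
        (swap (a.succAbove 3) (a.succAbove 4) * swap (a.succAbove 4) (a.succAbove 5)) =
      (swap (a.succAbove 3) (a.succAbove 4) * swap (a.succAbove 3) (a.succAbove 5)) *
        (swap (a.succAbove 3) (a.succAbove 4) * swap (a.succAbove 6) (a.succAbove 7)) := by
    decide
  refine four_dvd_finrank_of_commuting
    (c := (extendByZero ρ (swap (b 0) (b 1) * swap (b 1) (b 2))).restrict (hmem 0 1 1 2))
    (d := (extendByZero ρ (swap (b 3) (b 4) * swap (b 4) (b 5))).restrict (hmem 3 4 4 5))
    (g := (extendByZero ρ (swap (b 3) (b 4) * swap (b 6) (b 7))).restrict (hmem 3 4 6 7))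
    (LinearMap.ext fun u => Subtype.ext ?_) (LinearMap.ext fun u => Subtype.ext ?_)
    (LinearMap.ext fun u => Subtype.ext ?_) (LinearMap.ext fun u => Subtype.ext ?_)
    (LinearMap.ext fun u => Subtype.ext ?_) ?_
  · exact LinearMap.congr_fun
      (h.three_cycle (hb (by decide)) (hb (by decide)) (hb (by decide))) (u : V)
  · exact LinearMap.congr_fun
      (h.three_cycle (hb (by decide)) (hb (by decide)) (hb (by decide))) (u : V)
  · exact LinearMap.congr_fun (extendByZero_mul_comm (hb (by decide)) (hb (by decide))
      (hb (by decide)) (hb (by decide)) (hcd a)) (u : V)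
  · exact LinearMap.congr_fun (extendByZero_mul_comm (hb (by decide)) (hb (by decide))
      (hb (by decide)) (hb (by decide)) (hgc a)) (u : V)
  · exact LinearMap.congr_fun (h.mul_of_invert (hb (by decide)) (hb (by decide))
      (hb (by decide)) (hb (by decide)) (hb (by decide)) (hgd a)) (u : V)
  · intro u v huv
    have hgg : extendByZero ρ (swap (b 6) (b 7) * swap (b 3) (b 4)) *
        extendByZero ρ (swap (b 3) (b 4) * swap (b 6) (b 7)) = 1 := by
      rw [← extendByZero_mul_left ρ (sign_swap_mul_swap (hb (by decide)) (hb (by decide))),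
        mul_assoc, ← mul_assoc (swap (b 3) (b 4)), swap_mul_self, one_mul, swap_mul_self,
        extendByZero_one]
    have := congrArg (extendByZero ρ (swap (b 6) (b 7) * swap (b 3) (b 4)))
      (congrArg Subtype.val huv)
    simp only [LinearMap.coe_restrict_apply, ← Module.End.mul_apply, hgg, Module.End.one_apply]
      at this
    exact Subtype.ext this

theorem toSubmodule_eq_spreadMember (h : HasSpinRelation ρ) (hdim : finrank (ZMod 2) V = 8)
    {a : Fin 9} (U : Subrepresentation (ρ.comp (A8 a).subtype))
    (hU : U.toRepresentation.IsIrreducible) : U.toSubmodule = spreadMember ρ a := by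
  have : FiniteDimensional (ZMod 2) V := Module.finite_of_finrank_pos (by omega)
  have h4 := finrank_spreadMember h hdim a
  refine Submodule.eq_of_le_of_finrank_le (le_spreadMember h U hU) ?_
  rw [h4]
  refine Nat.le_of_dvd (Nat.pos_of_ne_zero fun h0 => ?_) (h.four_dvd_finrank U)
  have hbot := Submodule.finrank_eq_zero.1 h0
  refine bot_ne_top (α := Subrepresentation U.toRepresentation)
    (Subrepresentation.toSubmodule_injective ?_)
  ext u
  have hu : u = 0 := Subtype.ext ((Submodule.mem_bot (ZMod 2)).1 (hbot ▸ u.2))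
  rw [hu]
  exact ⟨fun _ => Submodule.mem_top, fun _ => Submodule.zero_mem _⟩

/-! ### Total singularity -/

theorem polar_apply_apply {Q : QuadraticForm (ZMod 2) V} (hQ : ∀ g v, Q (ρ g v) = Q v) (g : A9)
    (u v : V) : QuadraticMap.polar Q (ρ g u) (ρ g v) = QuadraticMap.polar Q u v := by
  simp only [QuadraticMap.polar, ← map_add, hQ]

theorem polar_extendByZero {Q : QuadraticForm (ZMod 2) V} (hQ : ∀ g v, Q (ρ g v) = Q v)
    (σ : Perm (Fin 9)) (u v : V) :
    QuadraticMap.polar Q (extendByZero ρ σ u) v =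
      QuadraticMap.polar Q u (extendByZero ρ σ⁻¹ v) := by
  by_cases hσ : sign σ = 1
  · have hv : extendByZero ρ σ (extendByZero ρ σ⁻¹ v) = v := by
      rw [← Module.End.mul_apply, ← extendByZero_mul_left ρ hσ, mul_inv_cancel, extendByZero_one,
        Module.End.one_apply]
    nth_rw 1 [← hv]
    rw [show σ = ((⟨σ, mem_alternatingGroup.2 hσ⟩ : A9) : Perm (Fin 9)) from rfl,
      extendByZero_coe, polar_apply_apply hQ]
  · rw [extendByZero_of_sign_ne ρ hσ, extendByZero_of_sign_ne ρ (by rwa [sign_inv]),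
      LinearMap.zero_apply, LinearMap.zero_apply, QuadraticMap.polar_zero_left,
      QuadraticMap.polar_zero_right]

/-- Vectors act on spin modules by self-adjoint operators. -/
theorem polar_ofTwist {Q : QuadraticForm (ZMod 2) V} (hQ : ∀ g v, Q (ρ g v) = Q v)
    (A : Finset (Fin 9)) (u v : V) :
    QuadraticMap.polar Q (ofTwist ρ A u) v = QuadraticMap.polar Q u (toTwist ρ A v) := by
  simp only [← QuadraticMap.polarBilin_apply_apply, ofTwist, toTwist, LinearMap.sum_apply, map_sum]
  refine Finset.sum_congr rfl fun i _ => ?_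
  rw [QuadraticMap.polarBilin_apply_apply, QuadraticMap.polarBilin_apply_apply,
    polar_extendByZero hQ, mul_inv_rev, swap_inv, swap_inv]

/-- `spreadMember ρ a` is both the range and the kernel of a self-adjoint operator, hence isotropic;
an additive function on it that is invariant under a three-cycle vanishes. -/
theorem isTotallySingular_spreadMember (h : HasSpinRelation ρ) {Q : QuadraticForm (ZMod 2) V}
    (hQ : ∀ g v, Q (ρ g v) = Q v) (a : Fin 9) : IsTotallySingular Q (spreadMember ρ a) := by
  have hiso (u v : V) (hu : u ∈ spreadMember ρ a) (hv : v ∈ spreadMember ρ a) :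
      Q (u + v) = Q u + Q v := by
    obtain ⟨w, rfl⟩ := exists_ofTwist_of_mem_spreadMember h hu
    have := polar_ofTwist hQ (Finset.univ.erase a) w v
    rw [mem_spreadMember.1 hv, QuadraticMap.polar_zero_right, QuadraticMap.polar] at this
    rw [← sub_eq_zero, ← this]
    abel
  intro u hu
  let b : Fin 8 → Fin 9 := a.succAbove
  have hba (i : Fin 8) : b i ≠ a := Fin.succAbove_ne a i
  have hb {i j : Fin 8} (hij : i ≠ j) : b i ≠ b j := Fin.succAbove_right_injective.ne hij
  have hs := sign_swap_mul_swap (hb (show (0 : Fin 8) ≠ 1 by decide))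
    (hb (show (1 : Fin 8) ≠ 2 by decide))
  let c : A9 := ⟨swap (b 0) (b 1) * swap (b 1) (b 2), mem_alternatingGroup.2 hs⟩
  have hca : c • a = a := by
    change swap (b 0) (b 1) (swap (b 1) (b 2) a) = a
    rw [swap_apply_of_ne_of_ne (hba 1).symm (hba 2).symm,
      swap_apply_of_ne_of_ne (hba 0).symm (hba 1).symm]
  have hc (v : V) (hv : v ∈ spreadMember ρ a) : ρ c v ∈ spreadMember ρ a := by
    simpa only [hca] using apply_mem_spreadMember h c hv
  have hrel := LinearMap.congr_fun (h.three_cycle (hb (show (0 : Fin 8) ≠ 1 by decide))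
    (hb (show (1 : Fin 8) ≠ 2 by decide)) (hb (show (0 : Fin 8) ≠ 2 by decide))) u
  change u + extendByZero ρ (c : Perm (Fin 9)) u +
    extendByZero ρ (c : Perm (Fin 9)) (extendByZero ρ (c : Perm (Fin 9)) u) = 0 at hrel
  rw [extendByZero_coe] at hrel
  have := congrArg Q hrel
  rw [hiso _ _ (add_mem hu (hc u hu)) (hc _ (hc u hu)), hiso _ _ hu (hc u hu), hQ, hQ, map_zero,
    ZModModule.add_self, zero_add, hQ] at this
  exact this

theorem isCompleteOrthogonalSpread_spreadMember (h : HasSpinRelation ρ)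
    (hdim : finrank (ZMod 2) V = 8) {Q : QuadraticForm (ZMod 2) V}
    (hQ : ∀ g v, Q (ρ g v) = Q v) :
    IsCompleteOrthogonalSpread Q (Set.range (spreadMember ρ)) := by
  have hinj : Function.Injective (spreadMember ρ) := by
    intro a b hab
    by_contra hne
    have h1 := (isCompl_spreadMember h hne).disjoint
    rw [← hab, disjoint_self] at h1
    have h2 := finrank_spreadMember h hdim a
    rw [h1, finrank_bot] at h2
    exact absurd h2 (by decide)
  refine ⟨4, by norm_num, ⟨hdim, ?_, ?_⟩, ?_⟩
  · rintro _ ⟨a, rfl⟩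
    exact ⟨finrank_spreadMember h hdim a, isTotallySingular_spreadMember h hQ a⟩
  · rintro _ ⟨a, rfl⟩ _ ⟨b, rfl⟩ hab
    exact (isCompl_spreadMember h fun h' => hab (congrArg _ h')).inf_eq_bot
  · rw [Set.ncard_range_of_injective hinj, Nat.card_fin, Nat.card_zmod]
    rfl

/-- The images of a member of the spread under coset representatives are all its members. -/
theorem range_map_spreadMember (h : HasSpinRelation ρ) (a : Fin 9) (g : Fin 9 → A9)
    (hg : Function.Bijective (fun i => (g i : A9 ⧸ A8 a))) :
    (Set.range fun i => (spreadMember ρ a).map (ρ (g i))) = Set.range (spreadMember ρ) := by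
  simp only [map_spreadMember h]
  have hinj : Function.Injective fun i => g i • a := by
    intro i j hij
    refine hg.1 (QuotientGroup.eq.2 ?_)
    rw [MulAction.mem_stabilizer_iff, mul_smul, inv_smul_eq_iff]
    exact hij.symm
  exact (Finite.injective_iff_surjective.1 hinj).range_comp (spreadMember ρ)

end Clifford

/-! ### A quadratic form from commuting three-cycles -/

section Blocks

variable {V : Type*} [AddCommGroup V] [Module (ZMod 2) V]

/-- On the plane over `𝔽₂` the indicator function of the nonzero vectors is the quadratic form
`x² + x * y + y²`. -/
theorem exists_quadraticForm_of_finrank_eq_two [DecidableEq V] (hV : finrank (ZMod 2) V = 2) :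
    ∃ Q : QuadraticForm (ZMod 2) V, ∀ v, Q v = if v = 0 then 0 else 1 := by
  have : FiniteDimensional (ZMod 2) V := Module.finite_of_finrank_pos (by omega)
  let e : V ≃ₗ[ZMod 2] (Fin 2 → ZMod 2) := (finBasisOfFinrankEq (ZMod 2) V hV).equivFun
  let x : V →ₗ[ZMod 2] ZMod 2 := LinearMap.proj 0 ∘ₗ e.toLinearMap
  let y : V →ₗ[ZMod 2] ZMod 2 := LinearMap.proj 1 ∘ₗ e.toLinearMap
  refine ⟨QuadraticMap.linMulLin x x + QuadraticMap.linMulLin x y + QuadraticMap.linMulLin y y,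
    fun v => ?_⟩
  have key : ∀ f : Fin 2 → ZMod 2, f 0 * f 0 + f 0 * f 1 + f 1 * f 1 = if f = 0 then 0 else 1 := by
    decide
  have h0 : v = 0 ↔ e v = 0 := (LinearEquiv.map_eq_zero_iff e).symm
  simp only [h0]
  exact key (e v)

/-- For commuting idempotents `p` and `q`, the idempotents `p * q`, `p * (q + 1)`, `(p + 1) * q` and
`(p + 1) * (q + 1)`. -/
def blockProj (p q : Module.End (ZMod 2) V) (b : ZMod 2 × ZMod 2) : Module.End (ZMod 2) V :=
  (p + b.1 • 1) * (q + b.2 • 1)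

theorem sum_blockProj (p q : Module.End (ZMod 2) V) : ∑ b, blockProj p q b = 1 := by
  have h (r : Module.End (ZMod 2) V) : ∑ b : ZMod 2, (r + b • 1) = 1 := by
    rw [show (Finset.univ : Finset (ZMod 2)) = {0, 1} from rfl, Finset.sum_pair (by decide),
      zero_smul, one_smul, add_zero, ← add_assoc, ZModModule.add_self, zero_add]
  simp only [blockProj, Fintype.sum_prod_type, ← Finset.mul_sum, h, mul_one]

theorem add_smul_one_mul {p : Module.End (ZMod 2) V} (hp : p * p = p) :
    ∀ b b' : ZMod 2, (p + b • 1) * (p + b' • 1) = if b = b' then p + b • 1 else 0 := by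
  have h2 : ∀ b : ZMod 2, b = 0 ∨ b = 1 := by decide
  have h1 : (p + 1) * p = 0 := by rw [add_mul, hp, one_mul, ZModModule.add_self]
  intro b b'
  rcases h2 b with rfl | rfl <;> rcases h2 b' with rfl | rfl
  · simp [hp]
  · simp [mul_add, hp, ZModModule.add_self]
  · simp [h1]
  · simp [mul_add, h1]

theorem blockProj_mul {p q : Module.End (ZMod 2) V} (hp : p * p = p) (hq : q * q = q)
    (hpq : p * q = q * p) (b b' : ZMod 2 × ZMod 2) :
    blockProj p q b * blockProj p q b' = if b = b' then blockProj p q b else 0 := by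
  have hcomm : (q + b.2 • 1) * (p + b'.1 • 1) = (p + b'.1 • 1) * (q + b.2 • 1) := by
    simp only [mul_add, add_mul, hpq, smul_mul_assoc, mul_smul_comm, one_mul, mul_one, smul_add,
      smul_comm b.2 b'.1]
    abel
  rw [blockProj, blockProj, mul_assoc, ← mul_assoc (q + _), hcomm, mul_assoc (p + b'.1 • 1),
    ← mul_assoc, add_smul_one_mul hp, add_smul_one_mul hq]
  by_cases h1 : b.1 = b'.1 <;> by_cases h2 : b.2 = b'.2 <;> simp [h1, h2, Prod.ext_iff]

/-- `g` permutes the blocks by a translation. -/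
theorem blockProj_mul_of_shift {p q g : Module.End (ZMod 2) V} {s t : ZMod 2}
    (hgp : g * p = (p + s • 1) * g) (hgq : g * q = (q + t • 1) * g) (b : ZMod 2 × ZMod 2) :
    g * blockProj p q b = blockProj p q (b + (s, t)) * g := by
  have h (r : Module.End (ZMod 2) V) (u b : ZMod 2) (hr : g * r = (r + u • 1) * g) :
      g * (r + b • 1) = (r + (b + u) • 1) * g := by
    rw [mul_add, hr, add_smul, mul_smul_comm, mul_one, add_mul, add_mul, add_mul, smul_mul_assoc,
      smul_mul_assoc, one_mul]
    abel
  rw [blockProj, ← mul_assoc, h p s b.1 hgp, mul_assoc, h q t b.2 hgq, ← mul_assoc]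
  rfl

/-- If operators permuting the blocks act transitively on them, all blocks have the same
dimension. -/
theorem four_mul_finrank_range_blockProj [FiniteDimensional (ZMod 2) V]
    {p q : Module.End (ZMod 2) V} (hp : p * p = p) (hq : q * q = q) (hpq : p * q = q * p)
    (hshift : ∀ s t : ZMod 2, ∃ g : Module.End (ZMod 2) V, Function.Injective g ∧
      g * p = (p + s • 1) * g ∧ g * q = (q + t • 1) * g) (b : ZMod 2 × ZMod 2) :
    4 * finrank (ZMod 2) (LinearMap.range (blockProj p q b)) = finrank (ZMod 2) V := by
  have hle (b b' : ZMod 2 × ZMod 2) : finrank (ZMod 2) (LinearMap.range (blockProj p q b)) ≤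
      finrank (ZMod 2) (LinearMap.range (blockProj p q b')) := by
    obtain ⟨g, hg, h1, h2⟩ := hshift (b' - b).1 (b' - b).2
    rw [(Submodule.equivMapOfInjective g hg _).finrank_eq]
    refine Submodule.finrank_mono ?_
    rintro _ ⟨_, ⟨v, rfl⟩, rfl⟩
    rw [← Module.End.mul_apply, blockProj_mul_of_shift h1 h2, Module.End.mul_apply,
      Prod.mk.eta, add_sub_cancel]
    exact ⟨_, rfl⟩
  let φ : V →ₗ[ZMod 2] ∀ b : ZMod 2 × ZMod 2, LinearMap.range (blockProj p q b) :=
    LinearMap.pi fun b => (blockProj p q b).rangeRestrict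
  have hφ : Function.Bijective φ := by
    constructor
    · rw [← LinearMap.ker_eq_bot, LinearMap.ker_eq_bot']
      intro v hv
      rw [← Module.End.one_apply (R := ZMod 2) v, ← sum_blockProj p q, LinearMap.sum_apply]
      exact Finset.sum_eq_zero fun b _ => congrArg Subtype.val (congrFun hv b)
    · intro w
      refine ⟨∑ b, (w b : V), funext fun b => Subtype.ext ?_⟩
      change blockProj p q b (∑ b, (w b : V)) = w b
      have hw (b' : ZMod 2 × ZMod 2) :
          blockProj p q b (w b') = if b = b' then (w b : V) else 0 := by
        obtain ⟨v, hv⟩ := (w b').2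
        rw [← hv, ← Module.End.mul_apply, blockProj_mul hp hq hpq]
        split_ifs with h
        · subst h
          exact hv
        · rfl
      rw [map_sum, Finset.sum_congr rfl fun b' _ => hw b', Finset.sum_ite_eq,
        if_pos (Finset.mem_univ b)]
  rw [(LinearEquiv.ofBijective φ hφ).finrank_eq, Module.finrank_pi_fintype,
    Finset.sum_congr rfl fun b' _ => le_antisymm (hle b' b) (hle b b')]
  simp

/-- The number of nonzero components is a quadratic form modulo two if the blocks are planes. -/
theorem exists_quadraticForm_blockProj [DecidableEq V] (p q : Module.End (ZMod 2) V)
    (hrank : ∀ b, finrank (ZMod 2) (LinearMap.range (blockProj p q b)) = 2) :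
    ∃ Q : QuadraticForm (ZMod 2) V, ∀ v, Q v = ∑ b, if blockProj p q b v = 0 then 0 else 1 := by
  choose n hn using fun b => exists_quadraticForm_of_finrank_eq_two (hrank b)
  refine ⟨∑ b, (n b).comp (blockProj p q b).rangeRestrict, fun v => ?_⟩
  rw [sum_apply]
  refine Finset.sum_congr rfl fun b _ => ?_
  rw [QuadraticMap.comp_apply, hn]
  exact if_congr Subtype.ext_iff rfl rfl

theorem blockForm_apply_of_shift [DecidableEq V] {p q g : Module.End (ZMod 2) V}
    {Q : QuadraticForm (ZMod 2) V}
    (hQ : ∀ v, Q v = ∑ b, if blockProj p q b v = 0 then 0 else 1) (hg : Function.Injective g)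
    {s t : ZMod 2} (hgp : g * p = (p + s • 1) * g) (hgq : g * q = (q + t • 1) * g) (v : V) :
    Q (g v) = Q v := by
  rw [hQ, hQ, ← Equiv.sum_comp (Equiv.addRight (s, t))]
  refine Finset.sum_congr rfl fun b _ => if_congr ?_ rfl rfl
  rw [Equiv.coe_addRight, ← Module.End.mul_apply, ← blockProj_mul_of_shift hgp hgq,
    Module.End.mul_apply, map_eq_zero_iff g hg]

theorem blockForm_nondegenerate [DecidableEq V] {p q c : Module.End (ZMod 2) V}
    (hp : p * p = p) (hq : q * q = q)
    (hpq : p * q = q * p) (hc : 1 + c + c * c = 0) (hcp : c * p = p * c) (hcq : c * q = q * c)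
    {Q : QuadraticForm (ZMod 2) V}
    (hQ : ∀ v, Q v = ∑ b, if blockProj p q b v = 0 then 0 else 1) :
    (QuadraticMap.polarBilin Q).Nondegenerate := by
  have hcb (b) (v : V) : blockProj p q b (c v) = c (blockProj p q b v) := by
    have := blockProj_mul_of_shift (g := c) (s := 0) (t := 0) (by rw [hcp, zero_smul, add_zero])
      (by rw [hcq, zero_smul, add_zero]) b
    rw [Prod.mk_zero_zero, add_zero] at this
    exact (LinearMap.congr_fun this v).symm
  have key (u : V) (hu : u ≠ 0) : ∃ v, QuadraticMap.polar Q u v ≠ 0 := by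
    obtain ⟨b, hb⟩ : ∃ b, blockProj p q b u ≠ 0 := by
      by_contra! h0
      apply hu
      rw [← Module.End.one_apply (R := ZMod 2) u, ← sum_blockProj p q, LinearMap.sum_apply]
      exact Finset.sum_eq_zero fun b _ => h0 b
    -- The plane of the block `b` is spanned by the component of `u` and its image under `c`.
    refine ⟨c (blockProj p q b u), ?_⟩
    have hc0 (w : V) (hw : w ≠ 0) : c w ≠ 0 := by
      intro h0
      have := LinearMap.congr_fun hc w
      simp [h0] at this
      exact hw this
    have hcc (w : V) (hw : w ≠ 0) : w + c w ≠ 0 := by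
      intro h0
      have := LinearMap.congr_fun hc w
      simp only [LinearMap.add_apply, Module.End.one_apply, Module.End.mul_apply, h0, zero_add,
        LinearMap.zero_apply] at this
      exact hc0 _ (hc0 w hw) this
    have hterm (b' : ZMod 2 × ZMod 2) :
        ((if blockProj p q b' (u + c (blockProj p q b u)) = 0 then 0 else 1) -
          (if blockProj p q b' u = 0 then 0 else 1) -
          (if blockProj p q b' (c (blockProj p q b u)) = 0 then 0 else 1) : ZMod 2) =
        if b' = b then 1 else 0 := by
      rw [map_add, hcb, ← Module.End.mul_apply (blockProj p q b'), blockProj_mul hp hq hpq]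
      split_ifs with h1 h2 h3 h4 <;> subst_vars <;> simp_all
    rw [QuadraticMap.polar, hQ, hQ, hQ, ← Finset.sum_sub_distrib, ← Finset.sum_sub_distrib,
      Finset.sum_congr rfl fun b' _ => hterm b', Finset.sum_ite_eq', if_pos (Finset.mem_univ b)]
    exact one_ne_zero
  constructor
  · intro u hu
    by_contra h0
    obtain ⟨v, hv⟩ := key u h0
    exact hv (hu v)
  · intro u hu
    by_contra h0
    obtain ⟨v, hv⟩ := key u h0
    rw [QuadraticMap.polar_comm] at hv
    exact hv (hu v)

end Blocks

section Clifford

open Equiv Equiv.Perm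

variable {V : Type*} [AddCommGroup V] [Module (ZMod 2) V] {ρ : Representation (ZMod 2) A9 V}

/-! ### Invariance of the form -/

theorem alternating_induction {P : Perm (Fin 9) → Prop} (h1 : P 1)
    (h3 : ∀ i j l, i ≠ j → j ≠ l → i ≠ l → P (swap i j * swap j l))
    (hmul : ∀ σ π, sign σ = 1 → sign π = 1 → P σ → P π → P (σ * π))
    (hinv : ∀ σ, sign σ = 1 → P σ → P σ⁻¹) (g : A9) : P g := by
  have hg : (g : Perm (Fin 9)) ∈ Subgroup.closure {σ : Perm (Fin 9) | IsThreeCycle σ} := by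
    rw [closure_three_cycles_eq_alternating]
    exact g.2
  generalize (g : Perm (Fin 9)) = π at hg
  have hs (σ : Perm (Fin 9)) (hσ : σ ∈ Subgroup.closure {σ : Perm (Fin 9) | IsThreeCycle σ}) :
      sign σ = 1 := by
    rw [closure_three_cycles_eq_alternating] at hσ
    exact mem_alternatingGroup.1 hσ
  induction hg using Subgroup.closure_induction with
  | mem σ hσ =>
    obtain ⟨a, ha⟩ : σ.support.Nonempty := by
      rw [← Finset.card_pos, IsThreeCycle.card_support hσ]
      norm_num
    have hnd := (IsThreeCycle.nodup_iff_mem_support hσ).2 ha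
    rw [(IsThreeCycle.eq_swap_mul_swap_iff_mem_support hσ).2 ha]
    simp only [List.nodup_cons, List.mem_cons, List.not_mem_nil, or_false, not_or] at hnd
    exact h3 _ _ _ hnd.1.1 hnd.2.1 hnd.1.2
  | one => exact h1
  | mul σ π hσ hπ ihσ ihπ => exact hmul σ π (hs σ hσ) (hs π hπ) ihσ ihπ
  | inv σ hσ ih => exact hinv σ (hs σ hσ) ih

/-- Let `Q` be invariant under a three-cycle `c`, and let `d` commute with `c` and preserve the
polar form of `Q`. Then `v ↦ Q (d v) - Q v` is additive and invariant under `c`, hence zero. -/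
theorem apply_eq_of_commute_of_polar {Q : QuadraticForm (ZMod 2) V} {c d : Module.End (ZMod 2) V}
    (hc : 1 + c + c * c = 0) (hQc : ∀ v, Q (c v) = Q v) (hcd : d * c = c * d)
    (hd : ∀ u v, QuadraticMap.polar Q (d u) (d v) = QuadraticMap.polar Q u v) (v : V) :
    Q (d v) = Q v := by
  have hadd (u v : V) : Q (d (u + v)) - Q (u + v) = (Q (d u) - Q u) + (Q (d v) - Q v) := by
    have := hd u v
    rw [QuadraticMap.polar, QuadraticMap.polar, ← map_add] at this
    linear_combination this
  have hinv (v : V) : Q (d (c v)) - Q (c v) = Q (d v) - Q v := by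
    rw [← Module.End.mul_apply d, hcd, Module.End.mul_apply, hQc, hQc]
  have h0 := LinearMap.congr_fun hc v
  simp only [LinearMap.add_apply, Module.End.one_apply, Module.End.mul_apply,
    LinearMap.zero_apply] at h0
  have h1 := hadd (v + c v) (c (c v))
  rw [h0, hadd, hinv (c v), hinv, map_zero, QuadraticMap.map_zero, sub_zero, ZModModule.add_self,
    zero_add] at h1
  exact sub_eq_zero.1 h1.symm

/-- The supports of the vectors of a basis of the space of even vectors: two vectors for each of the
triples `{0, 1, 2}`, `{3, 4, 5}`, `{6, 7, 8}`, and two unions of two of these triples. -/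
def evenBasis : Finset (Finset (Fin 9)) :=
  {{0, 1}, {1, 2}, {3, 4}, {4, 5}, {6, 7}, {7, 8}, {0, 1, 2, 3, 4, 5}, {3, 4, 5, 6, 7, 8}}

/-- Self-adjointness is linear in the vector, so that it passes from a basis to the transpositions.
-/
theorem polar_ofTwist_of_basis {Q : QuadraticForm (ZMod 2) V}
    (hA : ∀ A ∈ evenBasis, ∀ u v,
      QuadraticMap.polar Q (ofTwist ρ A u) v = QuadraticMap.polar Q u (toTwist ρ A v))
    {i j : Fin 9} (hij : i ≠ j) (u v : V) :
    QuadraticMap.polar Q (ofTwist ρ {i, j} u) v = QuadraticMap.polar Q u (toTwist ρ {i, j} v) := by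
  let P (A : Finset (Fin 9)) : Prop := ∀ u v,
    QuadraticMap.polar Q (ofTwist ρ A u) v = QuadraticMap.polar Q u (toTwist ρ A v)
  have hP {A B C : Finset (Fin 9)} (h1 : P A) (h2 : P B) (hC : symmDiff A B = C) : P C := by
    intro u v
    rw [← hC, ofTwist_symmDiff, toTwist_symmDiff, LinearMap.add_apply, LinearMap.add_apply,
      QuadraticMap.polar_add_left, QuadraticMap.polar_add_right, h1, h2]
  have h01 : P {0, 1} := hA _ (by decide)
  have h12 : P {1, 2} := hA _ (by decide)
  have h34 : P {3, 4} := hA _ (by decide)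
  have h45 : P {4, 5} := hA _ (by decide)
  have h67 : P {6, 7} := hA _ (by decide)
  have h78 : P {7, 8} := hA _ (by decide)
  have ht : P {0, 1, 2, 3, 4, 5} := hA _ (by decide)
  have ht' : P {3, 4, 5, 6, 7, 8} := hA _ (by decide)
  have h02 : P {0, 2} := hP h01 h12 (by decide)
  have h05 : P {0, 5} := hP (hP (C := {0, 3, 4, 5}) ht h12 (by decide)) h34 (by decide)
  have h04 : P {0, 4} := hP h05 h45 (by decide)
  have h03 : P {0, 3} := hP h04 h34 (by decide)
  have h58 : P {5, 8} := hP (hP (C := {5, 6, 7, 8}) ht' h34 (by decide)) h67 (by decide)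
  have h08 : P {0, 8} := hP h05 h58 (by decide)
  have h07 : P {0, 7} := hP h08 h78 (by decide)
  have h06 : P {0, 6} := hP h07 h67 (by decide)
  have h0 : ∀ i : Fin 9, i ≠ 0 → P {0, i} := by
    intro i hi
    fin_cases i
    · exact absurd rfl hi
    · exact h01
    · exact h02
    · exact h03
    · exact h04
    · exact h05
    · exact h06
    · exact h07
    · exact h08
  have hsymm : ∀ i j : Fin 9, i ≠ 0 → j ≠ 0 → i ≠ j →
      symmDiff ({0, i} : Finset (Fin 9)) {0, j} = {i, j} := by decide
  by_cases hi : i = 0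
  · subst hi
    exact h0 j hij.symm u v
  by_cases hj : j = 0
  · subst hj
    rw [Finset.pair_comm]
    exact h0 i hi u v
  exact hP (h0 i hi) (h0 j hj) (hsymm i j hi hj hij) u v

/-- A form for which all transpositions are self-adjoint is invariant under the alternating group.
-/
theorem polar_apply_apply_of_polar_ofTwist (h : HasSpinRelation ρ) {Q : QuadraticForm (ZMod 2) V}
    (hQ : ∀ i j : Fin 9, i ≠ j → ∀ u v, QuadraticMap.polar Q (ofTwist ρ {i, j} u) v =
      QuadraticMap.polar Q u (toTwist ρ {i, j} v)) (g : A9) (u v : V) :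
    QuadraticMap.polar Q (extendByZero ρ g u) (extendByZero ρ g v) = QuadraticMap.polar Q u v := by
  have hinv (σ : Perm (Fin 9)) (hσ : sign σ = 1) (v : V) :
      extendByZero ρ σ (extendByZero ρ σ⁻¹ v) = v := by
    rw [← Module.End.mul_apply, ← extendByZero_mul_left ρ hσ, mul_inv_cancel, extendByZero_one,
      Module.End.one_apply]
  revert u v
  refine alternating_induction (P := fun σ => ∀ u v, QuadraticMap.polar Q (extendByZero ρ σ u)
    (extendByZero ρ σ v) = QuadraticMap.polar Q u v) ?_ ?_ ?_ ?_ g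
  · intro u v
    rw [extendByZero_one, Module.End.one_apply, Module.End.one_apply]
  · intro i j l hij hjl hil u v
    have h1 : ofTwist ρ {j, l} * toTwist ρ {j, l} = 1 :=
      ofTwist_mul_toTwist_eq_one h (by rw [Finset.card_pair hjl])
    have h2 : toTwist ρ {i, j} * ofTwist ρ {i, j} = 1 :=
      toTwist_mul_ofTwist_eq_one h (by rw [Finset.card_pair hij])
    rw [← ofTwist_pair_mul_toTwist_pair h hij hjl, Module.End.mul_apply, Module.End.mul_apply,
      hQ i j hij, ← Module.End.mul_apply (toTwist ρ {i, j}), h2, Module.End.one_apply, ← hQ j l hjl,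
      ← Module.End.mul_apply, h1, Module.End.one_apply]
  · intro σ π hσ _ h1 h2 u v
    rw [extendByZero_mul_left ρ hσ, Module.End.mul_apply, Module.End.mul_apply, h1, h2]
  · intro σ hσ h1 u v
    rw [← h1, hinv σ hσ, hinv σ hσ]

/-- A quadratic form that is invariant under one three-cycle is invariant under the alternating
group if its polar form is: invariance passes on to disjoint three-cycles, and any two three-cycles
are disjoint from a third one. -/
theorem apply_eq_of_three_cycle (h : HasSpinRelation ρ) {Q : QuadraticForm (ZMod 2) V}
    (hpolar : ∀ (g : A9) u v, QuadraticMap.polar Q (extendByZero ρ g u) (extendByZero ρ g v) =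
      QuadraticMap.polar Q u v)
    (hc : ∀ v, Q (extendByZero ρ (swap 0 1 * swap 1 2) v) = Q v) (g : A9) (v : V) :
    Q (ρ g v) = Q v := by
  have hstep {a b c i j l : Fin 9} (hab : a ≠ b) (hbc : b ≠ c) (hac : a ≠ c) (hij : i ≠ j)
      (hjl : j ≠ l) (hd : Disjoint ({a, b, c} : Finset (Fin 9)) {i, j, l})
      (hQ : ∀ v, Q (extendByZero ρ (swap a b * swap b c) v) = Q v) (v : V) :
      Q (extendByZero ρ (swap i j * swap j l) v) = Q v := by
    simp only [Finset.disjoint_insert_left, Finset.disjoint_singleton_left, Finset.mem_insert,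
      Finset.mem_singleton, not_or] at hd
    obtain ⟨⟨a1, a2, a3⟩, ⟨b1, b2, b3⟩, c1, c2, c3⟩ := hd
    have hcomm {x y : Fin 9} (hxy : x ≠ y) (ha : a ≠ x) (hb : b ≠ x) (hc : c ≠ x) (ha' : a ≠ y)
        (hb' : b ≠ y) (hc' : c ≠ y) : Commute (swap x y) (swap a b * swap b c) := by
      refine (Disjoint.commute ?_).mul_right (Disjoint.commute ?_)
      · exact disjoint_swap_swap (by simp [hxy, ha.symm, hb.symm, ha'.symm, hb'.symm, hab])
      · exact disjoint_swap_swap (by simp [hxy, hb.symm, hc.symm, hb'.symm, hc'.symm, hbc])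
    have hs := sign_swap_mul_swap hij hjl
    refine apply_eq_of_commute_of_polar (h.three_cycle hab hbc hac) hQ ?_
      (hpolar ⟨_, mem_alternatingGroup.2 hs⟩) v
    exact extendByZero_mul_comm hij hjl hab hbc
      ((hcomm hij a1 b1 c1 a2 b2 c2).mul_left (hcomm hjl a2 b2 c2 a3 b3 c3))
  have hinv (σ : Perm (Fin 9)) (hσ : sign σ = 1) (v : V) :
      extendByZero ρ σ (extendByZero ρ σ⁻¹ v) = v := by
    rw [← Module.End.mul_apply, ← extendByZero_mul_left ρ hσ, mul_inv_cancel, extendByZero_one,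
      Module.End.one_apply]
  rw [← extendByZero_coe]
  revert v
  refine alternating_induction (P := fun σ => ∀ v, Q (extendByZero ρ σ v) = Q v) ?_ ?_ ?_ ?_ g
  · intro v
    rw [extendByZero_one, Module.End.one_apply]
  · intro i j l hij hjl hil
    have hcard : 2 < (({0, 1, 2} ∪ {i, j, l})ᶜ : Finset (Fin 9)).card := by
      rw [Finset.card_compl, Fintype.card_fin]
      have h1 := Finset.card_union_le {0, 1, 2} ({i, j, l} : Finset (Fin 9))
      have h2 : ({i, j, l} : Finset (Fin 9)).card ≤ 3 := Finset.card_le_three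
      have h3 : ({0, 1, 2} : Finset (Fin 9)).card = 3 := rfl
      omega
    obtain ⟨a, b, c, ha, hb, hc', hab, hac, hbc⟩ := Finset.two_lt_card_iff.1 hcard
    simp only [Finset.mem_compl, Finset.mem_union, not_or] at ha hb hc'
    have hd1 : Disjoint ({0, 1, 2} : Finset (Fin 9)) {a, b, c} := by
      simp only [Finset.disjoint_insert_right, Finset.disjoint_singleton_right]
      exact ⟨ha.1, hb.1, hc'.1⟩
    have hd2 : Disjoint ({a, b, c} : Finset (Fin 9)) {i, j, l} := by
      simp only [Finset.disjoint_insert_left, Finset.disjoint_singleton_left]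
      exact ⟨ha.2, hb.2, hc'.2⟩
    exact hstep hab hbc hac hij hjl hd2
      (hstep (by decide) (by decide) (by decide) hab hbc hd1 hc)
  · intro σ π hσ _ h1 h2 v
    rw [extendByZero_mul_left ρ hσ, Module.End.mul_apply, h1, h2]
  · intro σ hσ h1 v
    rw [← h1, hinv σ hσ]

theorem HasSpinRelation.toTwist_mul_of_commute (h : HasSpinRelation ρ) {A : Finset (Fin 9)}
    (hA : Even A.card) {i j l : Fin 9} (hij : i ≠ j) (hjl : j ≠ l)
    (hmap : A.map (swap i j * swap j l).toEmbedding = A)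
    (hconj : swap 0 1 * (swap i j * swap j l) * swap 0 1 = swap i j * swap j l) :
    toTwist ρ A * extendByZero ρ (swap i j * swap j l) =
      extendByZero ρ (swap i j * swap j l) * toTwist ρ A := by
  have := toTwist_map_mul h hA (sign_swap_mul_swap hij hjl)
  rwa [hmap, hconj] at this

theorem HasSpinRelation.toTwist_mul_of_invert (h : HasSpinRelation ρ) {A : Finset (Fin 9)}
    (hA : Even A.card) {i j l : Fin 9} (hij : i ≠ j) (hjl : j ≠ l) (hil : i ≠ l)
    (hmap : A.map (swap i j * swap j l).toEmbedding = A)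
    (hconj : swap 0 1 * (swap i j * swap j l) * swap 0 1 = swap i j * swap i l) :
    toTwist ρ A * extendByZero ρ (swap i j * swap j l) =
      (extendByZero ρ (swap i j * swap j l) + 1) * toTwist ρ A := by
  have := toTwist_map_mul h hA (sign_swap_mul_swap hij hjl)
  rwa [hmap, hconj, h.inverse_eq hij hjl hil] at this

/-- For the commuting three-cycles `c = (0 1 2)`, `d = (3 4 5)`, `e = (6 7 8)` the idempotents
`c + d` and `c + e` decompose the space into four planes. The number of nonzero components of a
vector in these planes is a quadratic form. It is invariant under operators permuting the planes,
among them enough vectors to make all transpositions self-adjoint for the polar form. -/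
theorem isOfQuadraticType_of_hasSpinRelation (h : HasSpinRelation ρ)
    (hdim : finrank (ZMod 2) V = 8) : IsOfQuadraticType ρ := by
  classical
  have : FiniteDimensional (ZMod 2) V := Module.finite_of_finrank_pos (by omega)
  set c := extendByZero ρ (swap 0 1 * swap 1 2) with hc
  set d := extendByZero ρ (swap 3 4 * swap 4 5) with hd
  set e := extendByZero ρ (swap 6 7 * swap 7 8) with he
  have hc1 : 1 + c + c * c = 0 := h.three_cycle (by decide) (by decide) (by decide)
  have hd1 : 1 + d + d * d = 0 := h.three_cycle (by decide) (by decide) (by decide)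
  have he1 : 1 + e + e * e = 0 := h.three_cycle (by decide) (by decide) (by decide)
  have hcd : c * d = d * c := extendByZero_mul_comm (by decide) (by decide) (by decide) (by decide)
    (by decide)
  have hce : c * e = e * c := extendByZero_mul_comm (by decide) (by decide) (by decide) (by decide)
    (by decide)
  have hde : d * e = e * d := extendByZero_mul_comm (by decide) (by decide) (by decide) (by decide)
    (by decide)
  have hp := add_mul_add_of_commuting hc1 hd1 hcd
  have hq := add_mul_add_of_commuting hc1 he1 hce
  have hpq : (c + d) * (c + e) = (c + e) * (c + d) := by
    rw [add_mul, mul_add, mul_add, add_mul, mul_add, mul_add, hcd, hce, hde]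
    abel
  have hinj {f g : Module.End (ZMod 2) V} (hfg : f * g = 1) : Function.Injective g := by
    intro u v huv
    have := congrArg f huv
    rwa [← Module.End.mul_apply, ← Module.End.mul_apply, hfg] at this
  -- `r`, `s` and `t` tell which of the cycles `c`, `d` and `e` are inverted by `g`.
  have hshift {g : Module.End (ZMod 2) V} {r s t : ZMod 2} (h1 : g * c = (c + r • 1) * g)
      (h2 : g * d = (d + s • 1) * g) (h3 : g * e = (e + t • 1) * g) :
      g * (c + d) = (c + d + (r + s) • 1) * g ∧ g * (c + e) = (c + e + (r + t) • 1) * g := by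
    constructor
    · rw [mul_add, h1, h2, ← add_mul, add_smul, add_add_add_comm]
    · rw [mul_add, h1, h3, ← add_mul, add_smul, add_add_add_comm]
  have hzero {g x : Module.End (ZMod 2) V} (hx : g * x = x * g) :
      g * x = (x + (0 : ZMod 2) • 1) * g := by
    rw [zero_smul, add_zero, hx]
  have hone {g x : Module.End (ZMod 2) V} (hx : g * x = (x + 1) * g) :
      g * x = (x + (1 : ZMod 2) • 1) * g := by
    rw [one_smul, hx]
  have hinj' {i j k l : Fin 9} (hij : i ≠ j) (hkl : k ≠ l) :
      Function.Injective (extendByZero ρ (swap i j * swap k l)) := by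
    refine hinj (f := extendByZero ρ (swap k l * swap i j)) ?_
    rw [← extendByZero_mul_left ρ (sign_swap_mul_swap hkl hij), mul_assoc,
      ← mul_assoc (swap i j), swap_mul_self, one_mul, swap_mul_self, extendByZero_one]
  have hrank (b : ZMod 2 × ZMod 2) :
      finrank (ZMod 2) (LinearMap.range (blockProj (c + d) (c + e) b)) = 2 := by
    have := four_mul_finrank_range_blockProj hp hq hpq ?_ b
    · omega
    have h2 : ∀ b : ZMod 2, b = 0 ∨ b = 1 := by decide
    intro s t
    rcases h2 s with rfl | rfl <;> rcases h2 t with rfl | rfl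
    · exact ⟨1, Function.injective_id, hzero (by rw [one_mul, mul_one]),
        hzero (by rw [one_mul, mul_one])⟩
    · refine ⟨extendByZero ρ (swap 0 1 * swap 3 4), hinj' (by decide) (by decide), ?_⟩
      exact hshift
        (hone (h.mul_of_invert (by decide) (by decide) (by decide) (by decide) (by decide)
          (by decide)))
        (hone (h.mul_of_invert (by decide) (by decide) (by decide) (by decide) (by decide)
          (by decide)))
        (hzero (extendByZero_mul_comm (by decide) (by decide) (by decide) (by decide)
          (by decide)))
    · refine ⟨extendByZero ρ (swap 0 1 * swap 6 7), hinj' (by decide) (by decide), ?_⟩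
      exact hshift
        (hone (h.mul_of_invert (by decide) (by decide) (by decide) (by decide) (by decide)
          (by decide)))
        (hzero (extendByZero_mul_comm (by decide) (by decide) (by decide) (by decide)
          (by decide)))
        (hone (h.mul_of_invert (by decide) (by decide) (by decide) (by decide) (by decide)
          (by decide)))
    · refine ⟨extendByZero ρ (swap 3 4 * swap 6 7), hinj' (by decide) (by decide), ?_⟩
      exact hshift
        (hzero (extendByZero_mul_comm (by decide) (by decide) (by decide) (by decide)
          (by decide)))
        (hone (h.mul_of_invert (by decide) (by decide) (by decide) (by decide) (by decide)
          (by decide)))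
        (hone (h.mul_of_invert (by decide) (by decide) (by decide) (by decide) (by decide)
          (by decide)))
  obtain ⟨Q, hQ⟩ := exists_quadraticForm_blockProj (c + d) (c + e) hrank
  have hQshift {g : Module.End (ZMod 2) V} {r s t : ZMod 2} (hg : Function.Injective g)
      (h1 : g * c = (c + r • 1) * g) (h2 : g * d = (d + s • 1) * g)
      (h3 : g * e = (e + t • 1) * g) (v : V) : Q (g v) = Q v :=
    blockForm_apply_of_shift hQ hg (hshift h1 h2 h3).1 (hshift h1 h2 h3).2 v
  have hQc (v : V) : Q (c v) = Q v :=
    hQshift (hinj' (by decide) (by decide)) (hzero rfl) (hzero hcd) (hzero hce) v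
  have hcard : ∀ A ∈ evenBasis, A.card % 4 = 2 := by
    intro A hA
    simp only [evenBasis, Finset.mem_insert, Finset.mem_singleton] at hA
    rcases hA with rfl | rfl | rfl | rfl | rfl | rfl | rfl | rfl <;> rfl
  have hQA : ∀ A ∈ evenBasis, ∀ v, Q (toTwist ρ A v) = Q v := by
    intro A hA v
    have hA' := hinj (ofTwist_mul_toTwist_eq_one h (hcard A hA))
    simp only [evenBasis, Finset.mem_insert, Finset.mem_singleton] at hA
    rcases hA with rfl | rfl | rfl | rfl | rfl | rfl | rfl | rfl
    · rw [toTwist_pair h (by decide)] at hA' ⊢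
      exact hQshift hA'
        (hzero (extendByZero_mul_comm (by decide) (by decide) (by decide) (by decide)
          (by decide)))
        (hzero (extendByZero_mul_comm (by decide) (by decide) (by decide) (by decide)
          (by decide)))
        (hzero (extendByZero_mul_comm (by decide) (by decide) (by decide) (by decide)
          (by decide))) v
    · rw [toTwist_pair h (by decide)] at hA' ⊢
      exact hQshift hA'
        (hzero (extendByZero_mul_comm (by decide) (by decide) (by decide) (by decide)
          (by decide)))
        (hzero (extendByZero_mul_comm (by decide) (by decide) (by decide) (by decide)
          (by decide)))
        (hzero (extendByZero_mul_comm (by decide) (by decide) (by decide) (by decide)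
          (by decide))) v
    · rw [toTwist_pair h (by decide)] at hA' ⊢
      exact hQshift hA'
        (hone (h.mul_of_invert (by decide) (by decide) (by decide) (by decide) (by decide)
          (by decide)))
        (hone (h.mul_of_invert (by decide) (by decide) (by decide) (by decide) (by decide)
          (by decide)))
        (hzero (extendByZero_mul_comm (by decide) (by decide) (by decide) (by decide)
          (by decide))) v
    · rw [toTwist_pair h (by decide)] at hA' ⊢
      exact hQshift hA'
        (hone (h.mul_of_invert (by decide) (by decide) (by decide) (by decide) (by decide)
          (by decide)))
        (hone (h.mul_of_invert (by decide) (by decide) (by decide) (by decide) (by decide)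
          (by decide)))
        (hzero (extendByZero_mul_comm (by decide) (by decide) (by decide) (by decide)
          (by decide))) v
    · rw [toTwist_pair h (by decide)] at hA' ⊢
      exact hQshift hA'
        (hone (h.mul_of_invert (by decide) (by decide) (by decide) (by decide) (by decide)
          (by decide)))
        (hzero (extendByZero_mul_comm (by decide) (by decide) (by decide) (by decide)
          (by decide)))
        (hone (h.mul_of_invert (by decide) (by decide) (by decide) (by decide) (by decide)
          (by decide))) v
    · rw [toTwist_pair h (by decide)] at hA' ⊢
      exact hQshift hA'
        (hone (h.mul_of_invert (by decide) (by decide) (by decide) (by decide) (by decide)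
          (by decide)))
        (hzero (extendByZero_mul_comm (by decide) (by decide) (by decide) (by decide)
          (by decide)))
        (hone (h.mul_of_invert (by decide) (by decide) (by decide) (by decide) (by decide)
          (by decide))) v
    -- The unions of two triples are fixed by all three cycles; `toTwist` conjugates by
    -- `(0 1)`, which inverts only `c`.
    · exact hQshift hA'
        (hone (h.toTwist_mul_of_invert (by decide) (by decide) (by decide) (by decide) (by decide)
          (by decide)))
        (hzero (h.toTwist_mul_of_commute (by decide) (by decide) (by decide) (by decide)
          (by decide)))
        (hzero (h.toTwist_mul_of_commute (by decide) (by decide) (by decide) (by decide)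
          (by decide))) v
    · exact hQshift hA'
        (hone (h.toTwist_mul_of_invert (by decide) (by decide) (by decide) (by decide) (by decide)
          (by decide)))
        (hzero (h.toTwist_mul_of_commute (by decide) (by decide) (by decide) (by decide)
          (by decide)))
        (hzero (h.toTwist_mul_of_commute (by decide) (by decide) (by decide) (by decide)
          (by decide))) v
  have hadj (i j : Fin 9) (hij : i ≠ j) (u v : V) :
      QuadraticMap.polar Q (ofTwist ρ {i, j} u) v =
        QuadraticMap.polar Q u (toTwist ρ {i, j} v) := by
    refine polar_ofTwist_of_basis (fun A hA u v => ?_) hij u v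
    -- An isometry is adjoint to its inverse.
    have hu : toTwist ρ A (ofTwist ρ A u) = u :=
      LinearMap.congr_fun (toTwist_mul_ofTwist_eq_one h (hcard A hA)) u
    nth_rw 2 [← hu]
    simp only [QuadraticMap.polar, ← map_add, hQA A hA]
  refine ⟨Q, blockForm_nondegenerate hp hq hpq hc1 ?_ ?_ hQ,
    apply_eq_of_three_cycle h (polar_apply_apply_of_polar_ofTwist h hadj) hQc⟩
  · rw [mul_add, add_mul, hcd]
  · rw [mul_add, add_mul, hce]

/-! ### The half-spin modules of the alternating group -/

/-- The relations pass from `D^{(5,4)}` to its subquotients. -/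
theorem hasSpinRelation_of_constituent (hV : IsIrreducibleConstituent ρ spinRepA9) :
    HasSpinRelation ρ := by
  obtain ⟨-, A, f, hf⟩ := hV
  intro i j l hij hjl hil
  refine LinearMap.ext fun v => ?_
  obtain ⟨x, rfl⟩ := hf v
  have hx (σ : Perm (Fin 9)) (hσ : sign σ = 1) : extendByZero ρ σ (f x) =
      f (A.toRepresentation ⟨σ, mem_alternatingGroup.2 hσ⟩ x) := by
    rw [extendByZero, dif_pos hσ]
    exact (LinearMap.congr_fun (f.isIntertwining' ⟨σ, mem_alternatingGroup.2 hσ⟩) x).symm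
  rw [LinearMap.add_apply, LinearMap.add_apply, Module.End.one_apply,
    hx _ (sign_swap_mul_swap hij hjl), hx _ (sign_swap_mul_swap hij hil), ← map_add, ← map_add,
    LinearMap.zero_apply, ← map_zero f]
  refine congrArg f (Subtype.ext ?_)
  exact twoPartRep_three_cycle (by norm_num) hij hjl hil (x : TwoPartModule 9 4)

end Clifford

theorem mainTheorem4 {V : Type*} [AddCommGroup V] [Module (ZMod 2) V]
    (ρ : Representation (ZMod 2) A9 V) (hdim : finrank (ZMod 2) V = 8)
    (hV : IsIrreducibleConstituent ρ spinRepA9) :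
    IsOfQuadraticType ρ ∧
    ∀ (a : Fin 9) (U : Subrepresentation (ρ.comp (A8 a).subtype)),
      U.toRepresentation.IsIrreducible →
        finrank (ZMod 2) U.toSubmodule = 4 ∧
        ∀ Q : QuadraticForm (ZMod 2) V, IsNondegenerateInvariantForm ρ Q →
          IsTotallySingular Q U.toSubmodule ∧
          ∀ g : Fin 9 → A9, Function.Bijective (fun i => (g i : A9 ⧸ A8 a)) →
            IsCompleteOrthogonalSpread Q
              (Set.range fun i => U.toSubmodule.map (ρ (g i))) := by
  have h := hasSpinRelation_of_constituent hV
  refine ⟨isOfQuadraticType_of_hasSpinRelation h hdim, fun a U hU => ?_⟩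
  rw [toSubmodule_eq_spreadMember h hdim U hU]
  refine ⟨finrank_spreadMember h hdim a, fun Q hQ =>
    ⟨isTotallySingular_spreadMember h hQ.2 a, fun g hg => ?_⟩⟩
  rw [range_map_spreadMember h a g hg]
  exact isCompleteOrthogonalSpread_spreadMember h hdim hQ.2
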